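/- Let $\mathcal A$ be a small preadditive category. Conventions. $\mathrm{Mod}\text{-}\mathcal A$ is the category of additive functors $\mathcal A^{\mathrm{op}}\to\mathrm{Ab}$, and $H_b=\mathcal A(-,b)$. The additive closure $\widehat{\mathcal A}$ has as objects the finite tuples of objects of $\mathcal A$ and as morphisms the matrices of morphisms of $\mathcal A$; the Cauchy completion $\widehat{\mathcal A}_\oplus$ is the idempotent completion of $\widehat{\mathcal A}$. An ideal $\mathcal I$ of a preadditive category $\mathcal B$ is a family of subgroups $\mathcal I(a,b)\le\mathcal B(a,b)$ closed under composition with arbitrary morphisms on both sides; it is idempotent if $\mathcal I\cdot\mathcal I=\mathcal I$, where $(\mathcal I\cdot\mathcal J)(a,b)$ consists of the finite sums of composites $\phi\circ\psi$ with $\psi\in\mathcal J(a,c)$ and $\phi\in\mathcal I(c,b)$. For a class $\mathcal S$ of modules, $\mathrm{tr}_{\mathcal S}(M)$ is the sum of the images of all morphisms $S\to M$ with $S\in\mathcal S$, and $\mathrm{tr}_{\mathcal S}(\mathcal A)$ is the ideal $(a,b)\mapsto \mathrm{tr}_{\mathcal S}(H_b)(a)$ of $\mathcal A$. A torsion pair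 is a pair $(\mathcal T,\mathcal F)$ of classes of modules with $\mathcal T={}^\perp\mathcal F$, $\mathcal F=\mathcal T^\perp$ such that every module $M$ lies in an exact sequence $0\to T\to M\to F\to 0$ with $T\in\mathcal T$, $F\in\mathcal F$; then $\mathcal T$ is a torsion class, hereditary if it is closed under submodules. A TTF triple in $\mathrm{Mod}\text{-}\mathcal A$ is a triple $({}^\perp\mathcal T,\mathcal T,\mathcal T^\perp)$, where $\mathcal T$ is a hereditary torsion class closed under products and ${}^\perp\mathcal T$ (resp. $\mathcal T^\perp$) consists of the modules with only zero morphisms to (resp. from) all members of $\mathcal T$; it is generated by a set $\mathcal S$ of modules if $\mathcal T=\mathcal S^\perp$. A recollement of $\mathrm{Mod}\text{-}\mathcal A$ by Abelian categories $\mathcal Y$ and $\mathcal X$ consists of additive functors forming adjoint triples $(i^*,i_*,i^!)$, with $i_*\colon\mathcal Y\to\mathrm{Mod}\text{-}\mathcal A$, and $(j_!,j^*,j_*)$, with $j^*\colon\mathrm{Mod}\text{-}\mathcal A\to\mathcal X$, such that $i_*,j_!,j_*$ are fully faithful and $\mathrm{Im}(i_*)=\mathrm{Ker}(j^*)$, where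 $\mathrm{Im}$ is the essential image; it is a recollement by module categories over small preadditive categories if $\mathcal Y$ and $\mathcal X$ are each equivalent to $\mathrm{Mod}\text{-}\mathcal B$ for some small preadditive category $\mathcal B$. Two recollements of $\mathrm{Mod}\text{-}\mathcal A$, with right-hand functors $j^*\colon \mathrm{Mod}\text{-}\mathcal A\to\mathcal X$ and $(j^*)'\colon \mathrm{Mod}\text{-}\mathcal A\to\mathcal X'$, are equivalent if there is an equivalence $\Psi\colon\mathcal X\to\mathcal X'$ with $\Psi\circ j^*\cong (j^*)'$. Theorem. The following are in one-to-one correspondence: (1) equivalence classes of recollements of $\mathrm{Mod}\text{-}\mathcal A$ by module categories over small preadditive categories; (2) TTF triples in $\mathrm{Mod}\text{-}\mathcal A$ generated by a set of finitely generated projective $\mathcal A$-modules; (3) idempotent ideals of $\mathcal A$ that are the trace in $\mathcal A$ of a set of finitely generated projective $\mathcal A$-modules; (4) idempotent ideals of the additive closure $\widehat{\mathcal A}$ generated by a set of idempotent endomorphisms; (5) full subcategories of the Cauchy completion $\widehat{\mathcal A}_\oplus$ closed under finite coproducts (including the empty one) and direct summands. More precisely, there are such bijections given as follows: (1)$\to$(2)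 sends the class of a recollement to $(\mathrm{Ker}(i^*),\mathrm{Im}(i_*),\mathrm{Ker}(i^!))$; (2)$\to$(3) sends $(\mathcal C,\mathcal T,\mathcal F)$ to the ideal of all morphisms $r$ with $T(r)=0$ for every $T\in\mathcal T$; (4)$\to$(3) restricts an ideal along the inclusion $\mathcal A\to\widehat{\mathcal A}$; and (5)$\to$(3) sends $\mathcal X$ to $\mathrm{tr}_{\mathcal X}(\mathcal A)$, where $Q\in\widehat{\mathcal A}_\oplus$ is viewed as the finitely generated projective $\mathcal A$-module $a\mapsto\widehat{\mathcal A}_\oplus(a,Q)$. -/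

import Mathlib

open CategoryTheory Opposite

universe u

noncomputable section

namespace RingsSeveralObjects

/-! ### Modules over a small preadditive category -/

section Modules

/-- Right modules over `A`: additive functors `Aᵒᵖ ⥤ Ab`, with all natural transformations. -/
abbrev RMod (A : Type u) [SmallCategory A] [Preadditive A] : Type (u + 1) :=
  Aᵒᵖ ⥤+ AddCommGrpCat.{u}

variable {A : Type u} [SmallCategory A] [Preadditive A]

/-- The representable module `H_b = A(-, b)`. -/
def representable (b : A) : RMod A :=
  AdditiveFunctor.of (preadditiveYoneda.obj b)

/-- `M` is finitely generated: there are finitely many elements `m i ∈ M (a i)` such that every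
element of every `M b` is of the form `∑ i, M (r i) (m i)` with `r i : b ⟶ a i`. -/
def IsFinGen (M : RMod A) : Prop :=
  ∃ (n : ℕ) (a : Fin n → A) (m : ∀ i, M.obj.obj (op (a i))),
    ∀ (b : A) (x : M.obj.obj (op b)),
      ∃ r : ∀ i, b ⟶ a i, x = ∑ i, (M.obj.map (r i).op).hom (m i)

/-- Finitely generated projective modules. -/
def IsFinGenProj (M : RMod A) : Prop :=
  IsFinGen M ∧ Projective M

/-- The trace of the class `S` in the module `M`, evaluated at `a`: the sum of the images of all
morphisms from members of `S` to `M`. -/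
def trace (S : ObjectProperty (RMod A)) (M : RMod A) (a : A) :
    AddSubgroup (M.obj.obj (op a)) :=
  ⨆ (N : RMod A) (_ : S N) (f : N ⟶ M), (f.hom.app (op a)).hom.range

end Modules

/-! ### Ideals of a preadditive category -/

section Ideals

/-- A two-sided ideal of a preadditive category. -/
@[ext]
structure CatIdeal (C : Type*) [Category* C] [Preadditive C] where
  /-- the subgroup `I(a, b)` of `C(a, b)` -/
  carrier : ∀ a b : C, AddSubgroup (a ⟶ b)
  comp_mem : ∀ {a' a b b' : C} (r : a' ⟶ a) (f : a ⟶ b) (l : b ⟶ b'),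
    f ∈ carrier a b → r ≫ f ≫ l ∈ carrier a' b'

namespace CatIdeal

variable {C : Type*} [Category* C] [Preadditive C]

/-- The product `I · J`: finite sums of composites `φ ∘ ψ` with `φ` in `I` and `ψ` in `J`. -/
def mul (I J : CatIdeal C) : CatIdeal C where
  carrier a b := AddSubgroup.closure
    {f | ∃ (c : C) (ψ : a ⟶ c) (φ : c ⟶ b), ψ ∈ J.carrier a c ∧ φ ∈ I.carrier c b ∧ f = ψ ≫ φ}
  comp_mem {a' a b b'} r f l hf := by
    induction hf using AddSubgroup.closure_induction with
    | mem x hx =>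
      obtain ⟨c, ψ, φ, hψ, hφ, rfl⟩ := hx
      refine AddSubgroup.subset_closure ⟨c, r ≫ ψ, φ ≫ l, ?_, ?_, by simp⟩
      · simpa using J.comp_mem r ψ (𝟙 c) hψ
      · simpa using I.comp_mem (𝟙 c) φ l hφ
    | zero => simp
    | add x y _ _ hx hy =>
      simpa [Preadditive.add_comp, Preadditive.comp_add] using add_mem hx hy
    | neg x _ hx => simpa [Preadditive.neg_comp, Preadditive.comp_neg] using neg_mem hx

/-- An ideal is idempotent when `I · I = I`. -/
def IsIdempotent (I : CatIdeal C) : Prop :=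
  I.mul I = I

/-- The ideal generated by a set `E` of endomorphisms (`E x` is the set of those elements of `E`
that are endomorphisms of `x`): the subgroups generated by the composites `δ ∘ ε ∘ γ`. -/
def span (E : ∀ x : C, Set (x ⟶ x)) : CatIdeal C where
  carrier a b := AddSubgroup.closure
    {f | ∃ (x : C) (ε : x ⟶ x) (γ : a ⟶ x) (δ : x ⟶ b), ε ∈ E x ∧ f = γ ≫ ε ≫ δ}
  comp_mem {a' a b b'} r f l hf := by
    induction hf using AddSubgroup.closure_induction with
    | mem y hy =>
      obtain ⟨x, ε, γ, δ, hε, rfl⟩ := hy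
      exact AddSubgroup.subset_closure ⟨x, ε, r ≫ γ, δ ≫ l, hε, by simp⟩
    | zero => simp
    | add x y _ _ hx hy =>
      simpa [Preadditive.add_comp, Preadditive.comp_add] using add_mem hx hy
    | neg x _ hx => simpa [Preadditive.neg_comp, Preadditive.comp_neg] using neg_mem hx

/-- `I` is generated by a set of idempotent endomorphisms. -/
def IsGeneratedByIdempotents (I : CatIdeal C) : Prop :=
  ∃ E : ∀ x : C, Set (x ⟶ x), (∀ x, ∀ ε ∈ E x, ε ≫ ε = ε) ∧ I = span E

end CatIdeal

variable {A : Type u} [SmallCategory A] [Preadditive A]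

/-- The trace of the class `S` in `A`: the ideal `(a, b) ↦ tr_S(H_b)(a) ⊆ A(a, b)`. -/
def traceIdeal (S : ObjectProperty (RMod A)) : CatIdeal A where
  carrier a b := trace S (representable b) a
  comp_mem {a' a b b'} r f l hf := by
    let φ : (a ⟶ b) →+ (a' ⟶ b') :=
      (Preadditive.rightComp a' l).comp (Preadditive.leftComp b r)
    have key : trace S (representable b) a ≤
        AddSubgroup.comap φ (trace S (representable b') a') := by
      refine iSup_le fun N => iSup_le fun hN => iSup_le fun g => ?_
      rintro _ ⟨y, rfl⟩
      let g' : N ⟶ representable b' :=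
        g ≫ ObjectProperty.homMk (preadditiveYoneda.map l)
      have h : trace S (representable b') a' ≥ (g'.hom.app (op a')).hom.range :=
        le_iSup_of_le N (le_iSup_of_le hN (le_iSup_of_le g' le_rfl))
      refine h ⟨(N.obj.map r.op).hom y, ?_⟩
      have e := ConcreteCategory.congr_hom (g.hom.naturality r.op) y
      exact (congrArg (fun z : a' ⟶ b => z ≫ l) e)
    have h2 := key hf
    rw [← Category.assoc]
    exact h2

/-- `I` is the trace in `A` of a (small) set of finitely generated projective modules. -/
def IsFgpTrace (I : CatIdeal A) : Prop :=
  ∃ (ι : Type u) (P : ι → RMod A), (∀ i, IsFinGenProj (P i)) ∧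
    I = traceIdeal (ObjectProperty.ofObj P)

end Ideals

/-! ### TTF triples -/

section TTF

/-- `(T, F)` is a torsion pair in `D`. -/
structure IsTorsionPair {D : Type*} [Category* D] [Preadditive D]
    (T F : ObjectProperty D) : Prop where
  eq_left : T = F.leftOrthogonal
  eq_right : F = T.rightOrthogonal
  exists_shortExact : ∀ X : D, ∃ (TX FX : D) (i : TX ⟶ X) (p : X ⟶ FX) (w : i ≫ p = 0),
    T TX ∧ F FX ∧ (ShortComplex.mk i p w).ShortExact

/-- A TTF triple `(C, T, F)`: `T` is a hereditary torsion class closed under (small) products,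
`C = ⊥T` and `F = T⊥`. -/
@[ext]
structure TTFTriple (D : Type (u + 1)) [Category.{u} D] [Preadditive D] where
  /-- the first class -/
  C : ObjectProperty D
  /-- the TTF class -/
  T : ObjectProperty D
  /-- the last class -/
  F : ObjectProperty D
  isTorsionPair : IsTorsionPair T F
  hereditary : T.IsClosedUnderSubobjects
  products : ∀ J : Type u, T.IsClosedUnderLimitsOfShape (Discrete J)
  eq_left : C = T.leftOrthogonal

variable {A : Type u} [SmallCategory A] [Preadditive A]

/-- The TTF triple is generated by a (small) set `S` of finitely generated projective modules,
that is, `T = S⊥`. -/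
def TTFTriple.IsFgpGenerated (τ : TTFTriple (RMod A)) : Prop :=
  ∃ (ι : Type u) (P : ι → RMod A), (∀ i, IsFinGenProj (P i)) ∧
    τ.T = (ObjectProperty.ofObj P).rightOrthogonal

/-- `r : a ⟶ b` acts as zero on all modules in the TTF class. -/
def TTFTriple.Annihilates (τ : TTFTriple (RMod A)) {a b : A} (r : a ⟶ b) : Prop :=
  ∀ M : RMod A, τ.T M → M.obj.map r.op = 0

end TTF

/-! ### Recollements -/

section Recollements

/-- A recollement of `D` by Abelian categories `Y` and `X`. -/
structure Recollement (D : Type (u + 1)) [Category.{u} D] [Preadditive D] where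
  /-- the category on the left -/
  Y : Type (u + 1)
  /-- the category on the right -/
  X : Type (u + 1)
  [categoryY : Category.{u} Y]
  [categoryX : Category.{u} X]
  [abelianY : Abelian Y]
  [abelianX : Abelian X]
  /-- `i_* : Y ⥤ D` -/
  iLowerStar : Y ⥤ D
  /-- `i^* : D ⥤ Y` -/
  iUpperStar : D ⥤ Y
  /-- `i^! : D ⥤ Y` -/
  iUpperShriek : D ⥤ Y
  /-- `j^* : D ⥤ X` -/
  jUpperStar : D ⥤ X
  /-- `j_! : X ⥤ D` -/
  jLowerShriek : X ⥤ D
  /-- `j_* : X ⥤ D` -/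
  jLowerStar : X ⥤ D
  additive_iLowerStar : iLowerStar.Additive
  additive_iUpperStar : iUpperStar.Additive
  additive_iUpperShriek : iUpperShriek.Additive
  additive_jUpperStar : jUpperStar.Additive
  additive_jLowerShriek : jLowerShriek.Additive
  additive_jLowerStar : jLowerStar.Additive
  /-- `i^* ⊣ i_*` -/
  adj_i₁ : iUpperStar ⊣ iLowerStar
  /-- `i_* ⊣ i^!` -/
  adj_i₂ : iLowerStar ⊣ iUpperShriek
  /-- `j_! ⊣ j^*` -/
  adj_j₁ : jLowerShriek ⊣ jUpperStar
  /-- `j^* ⊣ j_*` -/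
  adj_j₂ : jUpperStar ⊣ jLowerStar
  full_iLowerStar : iLowerStar.Full
  faithful_iLowerStar : iLowerStar.Faithful
  full_jLowerShriek : jLowerShriek.Full
  faithful_jLowerShriek : jLowerShriek.Faithful
  full_jLowerStar : jLowerStar.Full
  faithful_jLowerStar : jLowerStar.Faithful
  image_eq_kernel : iLowerStar.essImage = jUpperStar.kernel

attribute [instance] Recollement.categoryY Recollement.categoryX
  Recollement.abelianY Recollement.abelianX

variable {D : Type (u + 1)} [Category.{u} D] [Preadditive D]

/-- Two recollements of `D` are equivalent (over `D`) when there is an equivalence `Ψ` between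
their right-hand categories with `Ψ ∘ j^* ≅ j'^*`. -/
def Recollement.Equiv (R R' : Recollement D) : Prop :=
  ∃ Ψ : R.X ≌ R'.X, Nonempty (R.jUpperStar ⋙ Ψ.functor ≅ R'.jUpperStar)

/-- Both outer categories are equivalent to categories of modules over small preadditive
categories. -/
def Recollement.IsByModules (R : Recollement D) : Prop :=
  (∃ (B : Type u) (_ : SmallCategory B) (_ : Preadditive B), Nonempty (R.Y ≌ RMod B)) ∧
  (∃ (B : Type u) (_ : SmallCategory B) (_ : Preadditive B), Nonempty (R.X ≌ RMod B))

end Recollements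

/-! ### The five sets -/

section Sets

variable (A : Type u) [SmallCategory A] [Preadditive A]

/-- Recollements of the category of `A`-modules by categories of modules. -/
abbrev ModuleRecollement :=
  {R : Recollement (RMod A) // R.IsByModules}

/-- Equivalence of recollements is an equivalence relation. -/
instance recollementSetoid : Setoid (ModuleRecollement A) where
  r R R' := R.1.Equiv R'.1
  iseqv :=
    { refl := fun R => ⟨CategoryTheory.Equivalence.refl, ⟨Functor.rightUnitor _⟩⟩
      symm := by
        rintro R R' ⟨Ψ, ⟨α⟩⟩
        exact ⟨Ψ.symm, ⟨Functor.isoWhiskerRight α.symm Ψ.inverse ≪≫ Functor.associator _ _ _ ≪≫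
          Functor.isoWhiskerLeft _ Ψ.unitIso.symm ≪≫ Functor.rightUnitor _⟩⟩
      trans := by
        rintro R R' R'' ⟨Ψ, ⟨α⟩⟩ ⟨Ψ', ⟨α'⟩⟩
        exact ⟨Ψ.trans Ψ', ⟨(Functor.associator _ _ _).symm ≪≫
          Functor.isoWhiskerRight α Ψ'.functor ≪≫ α'⟩⟩ }

/-- Equivalence classes of recollements by categories of modules. -/
abbrev RecollementClasses := Quotient (recollementSetoid A)

/-- TTF triples generated by finitely generated projective modules. -/
abbrev FgpTTFTriples := {τ : TTFTriple (RMod A) // τ.IsFgpGenerated}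

/-- Idempotent ideals that are the trace of a set of finitely generated projective modules. -/
abbrev FgpTraceIdeals := {I : CatIdeal A // I.IsIdempotent ∧ IsFgpTrace I}

/-- The additive closure of `A`: finite tuples of objects, and matrices of morphisms. -/
abbrev AdditiveClosure := Mat_ A

/-- Idempotent ideals of the additive closure generated by a set of idempotent endomorphisms. -/
abbrev IdempotentGeneratedIdeals :=
  {J : CatIdeal (AdditiveClosure A) // J.IsIdempotent ∧ J.IsGeneratedByIdempotents}

/-- The Cauchy completion of `A`: the idempotent completion of the additive closure. -/
abbrev CauchyCompletion := Idempotents.Karoubi (AdditiveClosure A)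

/-- Full subcategories of the Cauchy completion closed under finite coproducts (so containing
the zero objects) and under direct summands (so closed under isomorphism). -/
abbrev CauchySubcategories :=
  {X : ObjectProperty (CauchyCompletion A) //
    X.IsClosedUnderFiniteCoproducts ∧ X.IsStableUnderRetracts}

variable {A}

/-- The module of an object `Q` of the Cauchy completion, `a ↦ Hom((a, id), Q)`;
this is the identification of the Cauchy completion with the finitely generated projective
modules. -/
def cauchyModule (Q : CauchyCompletion A) : RMod A :=
  AdditiveFunctor.of
    ((Mat_.embedding A ⋙ Idempotents.toKaroubi (AdditiveClosure A)).op ⋙ preadditiveYoneda.obj Q)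

/-- The class of modules corresponding to a class of objects of the Cauchy completion. -/
def cauchyModules (X : ObjectProperty (CauchyCompletion A)) : ObjectProperty (RMod A) :=
  fun M => ∃ Q, X Q ∧ M = cauchyModule Q

end Sets

end RingsSeveralObjects

end

/-! Everything is compared with the ideals in (3), and the main tool is the dual basis. A module `P`
is finitely generated projective exactly when it has finitely many generators g_i and linear forms
c_i with x = ∑ c_i(x)·g_i for every element x. Any f : P ⟶ M then satisfies f(x) = ∑ c_i(x)·f(g_i)
(`DualBasis.ev_eq_sum`). So the trace ideal of a class of such modules is idempotent, and a module
is right orthogonal to the class iff the trace annihilates it (`rightOrthogonal_eq_killedBy`). An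
ideal I is recovered from the modules it annihilates, because H_b / I(-, b) is one of them
(`mem_iff_forall_killedBy`). Thus TTF classes and trace ideals determine each other.

A dual basis also yields the idempotent matrix (c_j(g_i)), that is, an object of the Cauchy
completion. Ideals of the additive closure are determined by the entries of their matrices
(`CatIdeal.mem_iff_entry`), which gives (3)-(4). A subcategory as in (5) consists of the objects
whose idempotent has its entries in the trace (`eq_idealObjects`), which gives (3)-(5).

A recollement is determined up to equivalence by Ker j^*: the counit j_! j^* ⟶ id becomes invertible
under every exact functor that vanishes on this kernel (`Recollement.equiv_of_kernel_eq`). If the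
right-hand category consists of modules, j_! sends representables to finitely generated projectives,
and these generate the TTF triple (`isFinGenProj_leftAdjoint_obj`). Conversely, finitely generated
projectives P_i with trace I define j^* = Hom(P_i, -), with values in modules over the full
subcategory on the P_i, and i_* = restriction along A ⟶ A/I (`exists_recollement`). -/

noncomputable section

namespace RingsSeveralObjects

/-! ### Elements of modules, Yoneda's lemma and quotients. -/

section ModuleElements

variable {A : Type u} [SmallCategory A] [Preadditive A]

/-- The group of elements of the module `M` at `a`. -/
abbrev Elt (M : RMod A) (a : A) : Type u := M.obj.obj (op a)

/-- The action of a morphism of `A` on the elements of a module. -/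
def act (M : RMod A) {a b : A} (r : a ⟶ b) : Elt M b →+ Elt M a := (M.obj.map r.op).hom

/-- The component at `a` of a morphism of modules. -/
def ev {M N : RMod A} (f : M ⟶ N) (a : A) : Elt M a →+ Elt N a := (f.hom.app (op a)).hom

@[simp]
lemma act_id (M : RMod A) {a : A} (x : Elt M a) : act M (𝟙 a) x = x := by
  simp [act]

lemma act_comp (M : RMod A) {a b c : A} (r : a ⟶ b) (t : b ⟶ c) (x : Elt M c) :
    act M (r ≫ t) x = act M r (act M t x) := by
  simp [act]

lemma act_add (M : RMod A) {a b : A} (r t : a ⟶ b) (x : Elt M b) :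
    act M (r + t) x = act M r x + act M t x := by
  simp [act, Functor.map_add]

/-- The action of morphisms on a fixed element, as a homomorphism of groups. -/
def actHom (M : RMod A) {a b : A} (x : Elt M b) : (a ⟶ b) →+ Elt M a :=
  AddMonoidHom.mk' (fun r => act M r x) fun r t => act_add M r t x

@[simp]
lemma actHom_apply (M : RMod A) {a b : A} (x : Elt M b) (r : a ⟶ b) :
    actHom M x r = act M r x := rfl

@[simp]
lemma act_zero_left (M : RMod A) {a b : A} (x : Elt M b) : act M (0 : a ⟶ b) x = 0 :=
  (actHom M x).map_zero

lemma ev_act {M N : RMod A} (f : M ⟶ N) {a b : A} (r : a ⟶ b) (x : Elt M b) :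
    ev f a (act M r x) = act N r (ev f b x) :=
  ConcreteCategory.congr_hom (f.hom.naturality r.op) x

@[simp]
lemma ev_id (M : RMod A) (a : A) (x : Elt M a) : ev (𝟙 M) a x = x := rfl

@[simp]
lemma ev_comp {M N K : RMod A} (f : M ⟶ N) (g : N ⟶ K) (a : A) (x : Elt M a) :
    ev (f ≫ g) a x = ev g a (ev f a x) := rfl

@[simp]
lemma ev_zero {M N : RMod A} (a : A) (x : Elt M a) : ev (0 : M ⟶ N) a x = 0 := rfl

@[simp]
lemma ev_add {M N : RMod A} (f g : M ⟶ N) (a : A) (x : Elt M a) :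
    ev (f + g) a x = ev f a x + ev g a x := rfl

/-- Evaluation of morphisms at a fixed element. -/
def evHom (M N : RMod A) {a : A} (x : Elt M a) : (M ⟶ N) →+ Elt N a :=
  AddMonoidHom.mk' (fun f => ev f a x) fun f g => ev_add f g a x

lemma ev_sum {M N : RMod A} {ι : Type*} (s : Finset ι) (f : ι → (M ⟶ N)) {a : A} (x : Elt M a) :
    ev (∑ i ∈ s, f i) a x = ∑ i ∈ s, ev (f i) a x :=
  map_sum (evHom M N x) _ _

lemma rmod_hom_ext {M N : RMod A} {f g : M ⟶ N} (h : ∀ a x, ev f a x = ev g a x) : f = g := by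
  apply ObjectProperty.hom_ext
  ext a x
  exact h a.unop x

/-- A morphism of modules from its components. -/
def homOfEv {M N : RMod A} (φ : ∀ a, Elt M a →+ Elt N a)
    (h : ∀ {a b : A} (r : a ⟶ b) (x : Elt M b), φ a (act M r x) = act N r (φ b x)) : M ⟶ N :=
  ObjectProperty.homMk
    { app := fun a => AddCommGrpCat.ofHom (φ a.unop)
      naturality := fun _ _ r => by
        ext x
        exact h r.unop x }

/-- A module from its groups of elements and the action of morphisms. -/
def moduleOfAct (M : A → Type u) [∀ a, AddCommGroup (M a)]
    (φ : ∀ {a b : A}, (a ⟶ b) → (M b →+ M a)) (h_id : ∀ a x, φ (𝟙 a) x = x)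
    (h_comp : ∀ {a b c : A} (r : a ⟶ b) (t : b ⟶ c) x, φ (r ≫ t) x = φ r (φ t x))
    (h_add : ∀ {a b : A} (r t : a ⟶ b) x, φ (r + t) x = φ r x + φ t x) : RMod A :=
  ⟨{ obj := fun a => AddCommGrpCat.of (M a.unop)
     map := fun r => AddCommGrpCat.ofHom (φ r.unop)
     map_id := fun a => by
       ext x
       exact h_id a.unop x
     map_comp := fun r t => by
       ext x
       exact h_comp t.unop r.unop x },
   ⟨fun {_ _ r t} => by
     ext x
     exact h_add r.unop t.unop x⟩⟩

/-- The morphism from a representable module given by an element. -/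
def elt {M : RMod A} {a : A} (x : Elt M a) : representable a ⟶ M :=
  homOfEv (fun _ => actHom M x) fun r t => act_comp M r t x

lemma ev_representable {M : RMod A} {a b : A} (f : representable a ⟶ M) (r : b ⟶ a) :
    ev f b r = act M r (ev f a (𝟙 a)) :=
  (congrArg (ev f b) (Category.comp_id r).symm).trans (ev_act f r (𝟙 a))

lemma elt_ev_id {M : RMod A} {a : A} (f : representable a ⟶ M) : elt (ev f a (𝟙 a)) = f :=
  rmod_hom_ext fun _ r => (ev_representable f r).symm

lemma elt_comp {M N : RMod A} {a : A} (x : Elt M a) (f : M ⟶ N) : elt x ≫ f = elt (ev f a x) :=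
  rmod_hom_ext fun _ r => ev_act f r x

lemma elt_comp_elt {M : RMod A} {a b : A} (r : a ⟶ b) (x : Elt M b) :
    elt (M := representable b) r ≫ elt x = elt (act M r x) := elt_comp _ _

lemma elt_add {M : RMod A} {a : A} (x y : Elt M a) : elt (x + y) = elt x + elt y :=
  rmod_hom_ext fun _ r => map_add (act M r) x y

/-- Yoneda's lemma for modules. -/
def eltEquiv (M : RMod A) (a : A) : Elt M a ≃+ (representable a ⟶ M) where
  toFun := elt
  invFun f := ev f a (𝟙 a)
  left_inv x := act_id M x
  right_inv f := elt_ev_id f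
  map_add' := elt_add

lemma isZero_iff_elt (M : RMod A) : Limits.IsZero M ↔ ∀ a (x : Elt M a), x = 0 := by
  rw [Limits.IsZero.iff_id_eq_zero]
  refine ⟨fun h a x => ?_, fun h => rmod_hom_ext fun a x => h a x⟩
  rw [← ev_id M a x, h, ev_zero]

/-- A submodule. -/
structure SubMod (M : RMod A) where
  /-- the subgroups of elements -/
  carrier : ∀ a, AddSubgroup (Elt M a)
  act_mem : ∀ {a b : A} (r : a ⟶ b) {x : Elt M b}, x ∈ carrier b → act M r x ∈ carrier a

namespace SubMod

variable {M : RMod A} (U : SubMod M)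

/-- The quotient by a submodule. -/
def quot : RMod A :=
  moduleOfAct (fun a => Elt M a ⧸ U.carrier a)
    (fun {a b} r => QuotientAddGroup.map (U.carrier b) (U.carrier a) (act M r)
      fun _ hx => U.act_mem r hx)
    (fun a x => by
      induction x using QuotientAddGroup.induction_on
      exact congrArg _ (act_id M _))
    (fun r t x => by
      induction x using QuotientAddGroup.induction_on
      exact congrArg _ (act_comp M r t _))
    (fun r t x => by
      induction x using QuotientAddGroup.induction_on
      exact congrArg _ (act_add M r t _))

/-- The projection to the quotient. -/
def proj : M ⟶ U.quot :=
  homOfEv (fun a => QuotientAddGroup.mk' (U.carrier a)) fun _ _ => rfl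

lemma ev_proj_eq_zero {a : A} {x : Elt M a} : ev U.proj a x = 0 ↔ x ∈ U.carrier a :=
  QuotientAddGroup.eq_zero_iff x

lemma proj_surjective (a : A) : Function.Surjective (ev U.proj a) :=
  QuotientAddGroup.mk'_surjective _

end SubMod

/-- The submodule generated by the images of a family of morphisms. -/
def sumRange {M : RMod A} {J : Type*} {F : J → RMod A} (f : ∀ j, F j ⟶ M) : SubMod M where
  carrier a := ⨆ j, (ev (f j) a).range
  act_mem {a b} r x hx := by
    suffices h : (⨆ j, (ev (f j) b).range) ≤ (⨆ j, (ev (f j) a).range).comap (act M r) from h hx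
    refine iSup_le fun j => ?_
    rintro _ ⟨y, rfl⟩
    refine (le_iSup (fun j => (ev (f j) a).range) j) ⟨act _ r y, ev_act _ _ _⟩

/-- Elements are sums of elements in the images of the members of a jointly epimorphic family. -/
lemma mem_iSup_range_of_jointly_epi {M : RMod A} {J : Type*} {F : J → RMod A}
    (f : ∀ j, F j ⟶ M) (hf : ∀ (N : RMod A) (g : M ⟶ N), (∀ j, f j ≫ g = 0) → g = 0)
    {a : A} (x : Elt M a) : x ∈ ⨆ j, (ev (f j) a).range := by
  -- The projection onto the quotient by the sum of the images kills every `f j`, so joint epimorphy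
  -- makes it zero.
  have h : (sumRange f).proj = 0 := hf _ _ fun j => rmod_hom_ext fun b y =>
    (sumRange f).ev_proj_eq_zero.2 (le_iSup (fun j => (ev (f j) b).range) j ⟨y, rfl⟩)
  exact (sumRange f).ev_proj_eq_zero.1 (by rw [h]; rfl)

lemma surjective_of_epi {M N : RMod A} (f : M ⟶ N) [Epi f] (a : A) :
    Function.Surjective (ev f a) := by
  intro x
  have h := mem_iSup_range_of_jointly_epi (J := Unit) (fun _ => f)
    (fun _ g hg => by rw [← cancel_epi f, hg (), Limits.comp_zero]) x
  simpa using h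

lemma epi_of_surjective {M N : RMod A} (f : M ⟶ N) (hf : ∀ a, Function.Surjective (ev f a)) :
    Epi f where
  left_cancellation g h e := rmod_hom_ext fun a x => by
    obtain ⟨y, rfl⟩ := hf a x
    rw [← ev_comp, e, ev_comp]

lemma isIso_of_bijective {M N : RMod A} (f : M ⟶ N) (hf : ∀ a, Function.Bijective (ev f a)) :
    IsIso f := by
  let e := fun a => AddEquiv.ofBijective (ev f a) (hf a)
  refine ⟨homOfEv (fun a => (e a).symm.toAddMonoidHom) fun {a b} r x => ?_, ?_, ?_⟩
  · apply (e a).injective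
    obtain ⟨y, rfl⟩ := (e b).surjective x
    change (e a) ((e a).symm _) = ev f a (act M r ((e b).symm (e b y)))
    rw [AddEquiv.apply_symm_apply, AddEquiv.symm_apply_apply, ev_act]
    rfl
  · exact rmod_hom_ext fun a x => (e a).symm_apply_apply x
  · exact rmod_hom_ext fun a x => (e a).apply_symm_apply x

end ModuleElements

/-! ### Limits and colimits of additive functors. -/

section AbelianStructure

open Limits

variable {C D : Type*} [Category* C] [Category* D] [Preadditive C] [Preadditive D]

/-- Colimits of functors are computed objectwise, so additivity can be tested after composing with
the colimit injections, where it is additivity of the functors in the diagram. -/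
instance additiveFunctor_isClosedUnderColimitsOfShape (J : Type*) [Category* J]
    [HasColimitsOfShape J D] : (additiveFunctor C D).IsClosedUnderColimitsOfShape J where
  colimitsOfShape_le := by
    rintro G ⟨h⟩
    refine ⟨fun {X Y f g} => ?_⟩
    have hc := isColimitOfPreserves ((evaluation _ _).obj X) h.isColimit
    refine hc.hom_ext fun j => ?_
    have := h.prop_diag_obj j
    rw [additiveFunctor_iff] at this
    have n (r : X ⟶ Y) : (h.ι.app j).app X ≫ G.map r =
      (h.diag.obj j).map r ≫ (h.ι.app j).app Y := ((h.ι.app j).naturality r).symm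
    change (h.ι.app j).app X ≫ _ = (h.ι.app j).app X ≫ _
    rw [Preadditive.comp_add, n, n, n, Functor.map_add, Preadditive.add_comp]

instance additiveFunctor_isClosedUnderLimitsOfShape (J : Type*) [Category* J]
    [HasLimitsOfShape J D] : (additiveFunctor C D).IsClosedUnderLimitsOfShape J where
  limitsOfShape_le := by
    rintro G ⟨h⟩
    refine ⟨fun {X Y f g} => ?_⟩
    have hc := isLimitOfPreserves ((evaluation _ _).obj Y) h.isLimit
    refine hc.hom_ext fun j => ?_
    have := h.prop_diag_obj j
    rw [additiveFunctor_iff] at this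
    have n (r : X ⟶ Y) : G.map r ≫ (h.π.app j).app Y =
      (h.π.app j).app X ≫ (h.diag.obj j).map r := (h.π.app j).naturality r
    change _ ≫ (h.π.app j).app Y = _ ≫ (h.π.app j).app Y
    rw [Preadditive.add_comp, n, n, n, Functor.map_add, Preadditive.comp_add]

end AbelianStructure

section ModulesAbelian

variable {A : Type u} [SmallCategory A] [Preadditive A]

/-- This and the next three closure properties make `RMod A` an Abelian full subcategory of all
functors. -/
instance : (additiveFunctor Aᵒᵖ AddCommGrpCat.{u}).IsClosedUnderFiniteProducts where

instance : (additiveFunctor Aᵒᵖ AddCommGrpCat.{u}).ContainsZero where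
  exists_zero := ⟨_, Limits.isZero_zero _, ⟨fun {_ _ _ _} => (Limits.IsZero.eq_of_src
    (((evaluation _ _).obj _).map_isZero (Limits.isZero_zero _)) _ _)⟩⟩

instance : (additiveFunctor Aᵒᵖ AddCommGrpCat.{u}).IsClosedUnderKernels where
  kernels_le := by
    rintro _ ⟨f, k, hk, hX, hY⟩
    refine ObjectProperty.prop_of_isLimit _ hk ?_
    rintro (_ | _)
    · exact hX
    · exact hY

instance : (additiveFunctor Aᵒᵖ AddCommGrpCat.{u}).IsClosedUnderCokernels where
  cokernels_le := by
    rintro _ ⟨f, k, hk, hX, hY⟩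
    refine ObjectProperty.prop_of_isColimit _ hk ?_
    rintro (_ | _)
    · exact hX
    · exact hY

instance : Limits.HasLimits (RMod A) where

end ModulesAbelian

/-! ### Dual bases of finitely generated projective modules. -/

section FinGenProj

variable {A : Type u} [SmallCategory A] [Preadditive A]

/-- A finite dual basis of a module, indexed by `ι`. -/
structure DualBasis (P : RMod A) (ι : Type) [Fintype ι] where
  /-- the objects -/
  obj : ι → A
  /-- the generators -/
  gen : ∀ i, Elt P (obj i)
  /-- the coordinates -/
  coord : ∀ i, P ⟶ representable (obj i)
  eq_sum : ∀ {b : A} (x : Elt P b), x = ∑ i, act P (ev (coord i) b x) (gen i)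

namespace DualBasis

variable {P : RMod A} {ι : Type} [Fintype ι] (β : DualBasis P ι)

lemma ev_eq_sum {M : RMod A} (f : P ⟶ M) {b : A} (x : Elt P b) :
    ev f b x = ∑ i, act M (ev (β.coord i) b x) (ev f _ (β.gen i)) := by
  conv_lhs => rw [β.eq_sum x]
  rw [map_sum]
  exact Finset.sum_congr rfl fun i _ => ev_act f _ _

lemma id_eq_sum : 𝟙 P = ∑ i, β.coord i ≫ elt (β.gen i) :=
  rmod_hom_ext fun a x => by
    rw [ev_sum]
    exact β.eq_sum x

/-- A dual basis from a decomposition of the identity. -/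
def ofIdEqSum (obj : ι → A) (coord : ∀ i, P ⟶ representable (obj i))
    (q : ∀ i, representable (obj i) ⟶ P) (h : 𝟙 P = ∑ i, coord i ≫ q i) : DualBasis P ι where
  obj := obj
  gen i := ev (q i) _ (𝟙 _)
  coord := coord
  eq_sum {b} x := by
    conv_lhs => rw [← ev_id P b x, h, ev_sum]
    exact Finset.sum_congr rfl fun i _ => ev_representable (q i) _

-- To lift f through an epimorphism, lift each f(g_i) to an element y_i and send x to ∑ c_i(x)·y_i.
include β in
lemma projective : Projective P where
  factors {M N} f g _ := by
    choose y hy using fun i => surjective_of_epi g _ (ev f _ (β.gen i))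
    refine ⟨∑ i, β.coord i ≫ elt (y i), rmod_hom_ext fun b x => ?_⟩
    rw [ev_comp, ev_sum, map_sum, β.ev_eq_sum f x]
    refine Finset.sum_congr rfl fun i _ => ?_
    rw [ev_comp, ← hy i]
    exact ev_act g _ _

include β in
lemma isFinGen : IsFinGen P := by
  let e := Fintype.equivFin ι
  refine ⟨Fintype.card ι, fun i => β.obj (e.symm i), fun i => β.gen (e.symm i), fun b x =>
    ⟨fun i => ev (β.coord (e.symm i)) b x, ?_⟩⟩
  rw [Equiv.sum_comp e.symm (fun i => (P.obj.map (Quiver.Hom.op (ev (β.coord i) b x))).hom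
    (β.gen i))]
  exact β.eq_sum x

include β in
lemma isFinGenProj : IsFinGenProj P := ⟨β.isFinGen, β.projective⟩

end DualBasis

/-- The generators define an epimorphism from a finite sum of representables. Projectivity splits
it, and the components of the section are the coordinates. -/
lemma IsFinGenProj.exists_dualBasis {P : RMod A} (hP : IsFinGenProj P) :
    ∃ n : ℕ, Nonempty (DualBasis P (Fin n)) := by
  obtain ⟨⟨n, a, m, h⟩, _⟩ := hP
  refine ⟨n, ?_⟩
  have : Limits.HasFiniteBiproducts (RMod A) := Limits.HasFiniteBiproducts.of_hasFiniteProducts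
  let E : RMod A := ⨁ fun i => representable (a i)
  let q : E ⟶ P := Limits.biproduct.desc fun i => elt (m i)
  have hq (i) : Limits.biproduct.ι (fun i => representable (a i)) i ≫ q = elt (m i) :=
    Limits.biproduct.ι_desc _ _
  have : Epi q := epi_of_surjective q fun b x => by
    obtain ⟨r, rfl⟩ := h b x
    refine ⟨∑ i, ev (Limits.biproduct.ι (fun i => representable (a i)) i) b (r i), ?_⟩
    rw [map_sum]
    exact Finset.sum_congr rfl fun i _ => congrArg (fun g => ev g b (r i)) (hq i)
  let s := Projective.factorThru (𝟙 P) q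
  refine ⟨DualBasis.ofIdEqSum a (fun i => s ≫ Limits.biproduct.π _ i) (fun i => elt (m i)) ?_⟩
  rw [← Projective.factorThru_comp (𝟙 P) q]
  change s ≫ q = _
  have := (Limits.biproduct.total (f := fun i => representable (a i))).symm
  rw [← Category.id_comp q, this, Preadditive.sum_comp, Preadditive.comp_sum]
  simp only [Category.assoc, hq]

end FinGenProj

/-! ### Trace ideals and the modules they annihilate. -/

section Trace

variable {A : Type u} [SmallCategory A] [Preadditive A]

lemma ev_mem_trace {S : ObjectProperty (RMod A)} {N M : RMod A} (hN : S N) (f : N ⟶ M) {a : A}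
    (x : Elt N a) : ev f a x ∈ trace S M a :=
  le_iSup_of_le (f := fun N : RMod A => ⨆ (_ : S N) (f : N ⟶ M), (f.hom.app (op a)).hom.range) N
    (le_iSup_of_le (f := fun _ : S N => ⨆ (f : N ⟶ M), (f.hom.app (op a)).hom.range) hN
      (le_iSup (fun f : N ⟶ M => (f.hom.app (op a)).hom.range) f)) ⟨x, rfl⟩

lemma trace_le {S : ObjectProperty (RMod A)} {M : RMod A} {a : A} {U : AddSubgroup (Elt M a)}
    (h : ∀ (N : RMod A) (_ : S N) (f : N ⟶ M) (x : Elt N a), ev f a x ∈ U) : trace S M a ≤ U := by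
  refine iSup_le fun N => iSup_le fun hN => iSup_le fun f => ?_
  rintro _ ⟨x, rfl⟩
  exact h N hN f x

lemma ev_mem_traceIdeal {S : ObjectProperty (RMod A)} {N : RMod A} (hN : S N) {a b : A}
    (f : N ⟶ representable b) (x : Elt N a) : ev f a x ∈ (traceIdeal S).carrier a b :=
  ev_mem_trace hN f x

lemma traceIdeal_le {S : ObjectProperty (RMod A)} {a b : A} {U : AddSubgroup (a ⟶ b)}
    (h : ∀ (N : RMod A) (_ : S N) (f : N ⟶ representable b) (x : Elt N a), ev f a x ∈ U) :
    (traceIdeal S).carrier a b ≤ U :=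
  trace_le h

namespace CatIdeal

variable {C : Type*} [Category* C] [Preadditive C] (I : CatIdeal C)

lemma comp_mem_left {a b c : C} (r : a ⟶ b) {f : b ⟶ c} (hf : f ∈ I.carrier b c) :
    r ≫ f ∈ I.carrier a c := by
  simpa using I.comp_mem r f (𝟙 c) hf

lemma comp_mem_right {a b c : C} {f : a ⟶ b} (l : b ⟶ c) (hf : f ∈ I.carrier a b) :
    f ≫ l ∈ I.carrier a c := by
  simpa using I.comp_mem (𝟙 a) f l hf

lemma ext_of_mem {I J : CatIdeal C} (h : ∀ (a b : C) (f : a ⟶ b),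
    f ∈ I.carrier a b ↔ f ∈ J.carrier a b) : I = J :=
  CatIdeal.ext (funext fun a => funext fun b => AddSubgroup.ext (h a b))

lemma mul_self_le {a b : C} : (I.mul I).carrier a b ≤ I.carrier a b := by
  refine (AddSubgroup.closure_le _).2 ?_
  rintro _ ⟨c, ψ, φ, hψ, -, rfl⟩
  exact I.comp_mem_right _ hψ

variable {I} in
lemma isIdempotent_of_le (h : ∀ a b, I.carrier a b ≤ (I.mul I).carrier a b) : I.IsIdempotent :=
  ext_of_mem fun a b _ => ⟨fun hf => I.mul_self_le hf, fun hf => h a b hf⟩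

lemma comp_mem_mul {a b c : C} {f : a ⟶ b} {g : b ⟶ c} (hf : f ∈ I.carrier a b)
    (hg : g ∈ I.carrier b c) : f ≫ g ∈ (I.mul I).carrier a c :=
  AddSubgroup.subset_closure ⟨b, f, g, hf, hg, rfl⟩

end CatIdeal

lemma DualBasis.coord_mem {S : ObjectProperty (RMod A)} {P : RMod A} (hP : S P) {ι : Type}
    [Fintype ι] (β : DualBasis P ι) (i : ι) {b : A} (x : Elt P b) :
    ev (β.coord i) b x ∈ (traceIdeal S).carrier b (β.obj i) :=
  ev_mem_traceIdeal hP _ _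

/-- In f(x) = ∑ c_i(x)·f(g_i), both factors of each summand are values of linear forms on `P`, hence
lie in the trace. -/
lemma isIdempotent_traceIdeal {S : ObjectProperty (RMod A)} (hS : ∀ P, S P → IsFinGenProj P) :
    (traceIdeal S).IsIdempotent := by
  refine CatIdeal.isIdempotent_of_le fun a b => traceIdeal_le fun P hP f x => ?_
  obtain ⟨n, ⟨β⟩⟩ := (hS P hP).exists_dualBasis
  rw [β.ev_eq_sum f x]
  exact AddSubgroup.sum_mem _ fun i _ =>
    CatIdeal.comp_mem_mul _ (β.coord_mem hP i x) (ev_mem_traceIdeal hP f _)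

/-- The class of modules annihilated by an ideal. -/
def killedBy (I : CatIdeal A) : ObjectProperty (RMod A) :=
  fun M => ∀ {a b : A} (r : a ⟶ b), r ∈ I.carrier a b → ∀ x : Elt M b, act M r x = 0

/-- An element x of M at b is a morphism H_b ⟶ M, and its composite with P ⟶ H_b vanishes when M is
orthogonal to P. Conversely, a morphism P ⟶ M is computed by letting the coordinates, which lie in
the trace, act on the images of the generators. -/
lemma rightOrthogonal_eq_killedBy {S : ObjectProperty (RMod A)}
    (hS : ∀ P, S P → IsFinGenProj P) : S.rightOrthogonal = killedBy (traceIdeal S) := by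
  ext M
  refine ⟨fun h a b r hr x => ?_, fun h P f hP => rmod_hom_ext fun b x => ?_⟩
  · suffices hle : (traceIdeal S).carrier a b ≤ (actHom M x).ker from hle hr
    refine traceIdeal_le fun P hP f y => ?_
    change ev (elt x) a (ev f a y) = 0
    rw [← ev_comp, h (f ≫ elt x) hP, ev_zero]
  · obtain ⟨n, ⟨β⟩⟩ := (hS P hP).exists_dualBasis
    rw [β.ev_eq_sum f x, ev_zero]
    exact Finset.sum_eq_zero fun i _ => h _ (β.coord_mem hP i x) _

/-- An ideal as a submodule of a representable module. -/
def CatIdeal.subMod (I : CatIdeal A) (b : A) : SubMod (representable b) where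
  carrier a := I.carrier a b
  act_mem r _ hx := I.comp_mem_left r hx

lemma killedBy_quot (I : CatIdeal A) (b : A) : killedBy I (I.subMod b).quot := by
  intro a c r hr x
  obtain ⟨y, rfl⟩ := (I.subMod b).proj_surjective c x
  rw [← ev_act, SubMod.ev_proj_eq_zero]
  exact I.comp_mem_right y hr

/-- The test module is H_b / I(-, b): there r sends the class of the identity to the class of r. -/
lemma mem_iff_forall_killedBy (I : CatIdeal A) {a b : A} (r : a ⟶ b) :
    r ∈ I.carrier a b ↔ ∀ M, killedBy I M → ∀ x : Elt M b, act M r x = 0 := by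
  refine ⟨fun hr M hM x => hM r hr x, fun h => ?_⟩
  have := h _ (killedBy_quot I b) (ev (I.subMod b).proj b (𝟙 b))
  exact (I.subMod b).ev_proj_eq_zero.1 ((ev_representable (I.subMod b).proj r).trans this)

/-- The trace of an arbitrary class of finitely generated projective modules is the trace of a
small set of such. -/
lemma isFgpTrace_traceIdeal {S : ObjectProperty (RMod A)} (hS : ∀ P, S P → IsFinGenProj P) :
    IsFgpTrace (traceIdeal S) := by
  -- Smallness: one witness is chosen for each morphism of `A` that is a value of a linear form on a
  -- member of `S`, and the morphisms of `A` form a small set.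
  let J := {t : Σ (a b : A), (a ⟶ b) // ∃ (N : RMod A) (_ : S N)
    (f : N ⟶ representable t.2.1) (x : Elt N t.1), ev f t.1 x = t.2.2}
  choose N hN f x hx using fun t : J => t.2
  refine ⟨J, N, fun i => hS _ (hN i), CatIdeal.ext_of_mem fun a b r => ⟨fun hr => ?_, fun hr => ?_⟩⟩
  · refine traceIdeal_le (fun P hP g y => ?_) hr
    let t : J := ⟨⟨a, b, ev g a y⟩, P, hP, g, y, rfl⟩
    have := ev_mem_traceIdeal (ObjectProperty.ofObj_apply N t) (f t) (x t)
    rw [hx t] at this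
    exact this
  · refine traceIdeal_le (fun P hP g y => ?_) hr
    obtain ⟨t⟩ := hP
    exact ev_mem_traceIdeal (hN t) g y

end Trace

section AdditiveClosures

variable {A : Type u} [SmallCategory A] [Preadditive A]

/-! ### Ideals of the additive closure and their entries. -/

section Matrices

/-- An entry of a matrix of morphisms. -/
def entry {M N : Mat_ A} (i : M.ι) (j : N.ι) : (M ⟶ N) →+ (M.X i ⟶ N.X j) where
  toFun f := f i j
  map_zero' := rfl
  map_add' _ _ := rfl

/-- A matrix of morphisms from its entries. -/
def ofEntries {M N : Mat_ A} (f : ∀ i j, M.X i ⟶ N.X j) : M ⟶ N := f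

lemma mat_hom_ext {M N : Mat_ A} {f g : M ⟶ N} (h : ∀ i j, entry i j f = entry i j g) : f = g :=
  Mat_.hom_ext f g h

lemma entry_comp {M N K : Mat_ A} (f : M ⟶ N) (g : N ⟶ K) (i : M.ι) (k : K.ι) :
    entry i k (f ≫ g) = ∑ j, entry i j f ≫ entry j k g := rfl

/-- The inclusion of a component of a tuple. -/
def matInj (M : Mat_ A) (i : M.ι) : (Mat_.embedding A).obj (M.X i) ⟶ M :=
  ofEntries fun _ k => entry i k (𝟙 M)

/-- The projection to a component of a tuple. -/
def matProj (M : Mat_ A) (i : M.ι) : M ⟶ (Mat_.embedding A).obj (M.X i) :=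
  ofEntries fun k _ => entry k i (𝟙 M)

/-- The morphism between one-element tuples given by an entry. -/
def embEntry {M N : Mat_ A} (i : M.ι) (j : N.ι) (f : M ⟶ N) :
    (Mat_.embedding A).obj (M.X i) ⟶ (Mat_.embedding A).obj (N.X j) :=
  (Mat_.embedding A).map (entry i j f)

lemma matInj_comp_matProj {M N : Mat_ A} (f : M ⟶ N) (i : M.ι) (j : N.ι) :
    matInj M i ≫ f ≫ matProj N j = embEntry i j f := by
  have h : entry i j (𝟙 M ≫ f ≫ 𝟙 N) = entry i j f := by simp
  refine mat_hom_ext fun _ _ => Eq.trans ?_ h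
  rfl

lemma sum_matProj_comp_matInj (M : Mat_ A) : ∑ i, matProj M i ≫ matInj M i = 𝟙 M := by
  refine mat_hom_ext fun k l => ?_
  rw [← Category.comp_id (𝟙 M), entry_comp, map_sum]
  refine Finset.sum_congr rfl fun i _ => ?_
  rw [entry_comp]
  exact Fintype.sum_unique (ι := PUnit) _

lemma eq_sum_embEntry {M N : Mat_ A} (f : M ⟶ N) :
    f = ∑ i, ∑ j, matProj M i ≫ embEntry i j f ≫ matInj N j := by
  conv_lhs => rw [← Category.id_comp f, ← Category.comp_id f, ← sum_matProj_comp_matInj M,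
    ← sum_matProj_comp_matInj N, Preadditive.sum_comp]
  refine Finset.sum_congr rfl fun i _ => ?_
  rw [Preadditive.comp_sum, Preadditive.comp_sum]
  refine Finset.sum_congr rfl fun j _ => ?_
  rw [← matInj_comp_matProj]
  simp only [Category.assoc]

/-- The restriction to `A` of an ideal of the additive closure. -/
def resIdeal (J : CatIdeal (Mat_ A)) : CatIdeal A where
  carrier a b := (J.carrier _ _).comap ((Mat_.embedding A).mapAddHom (X := a) (Y := b))
  comp_mem r f l hf := by
    have := J.comp_mem ((Mat_.embedding A).map r) ((Mat_.embedding A).map f)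
      ((Mat_.embedding A).map l) hf
    rwa [← Functor.map_comp, ← Functor.map_comp] at this

lemma mem_resIdeal {J : CatIdeal (Mat_ A)} {a b : A} {r : a ⟶ b} :
    r ∈ (resIdeal J).carrier a b ↔ (Mat_.embedding A).map r ∈ J.carrier _ _ := Iff.rfl

/-- The ideal of matrices with entries in an ideal of `A`. -/
def matIdeal (I : CatIdeal A) : CatIdeal (Mat_ A) where
  carrier M N := ⨅ (i) (j), (I.carrier (M.X i) (N.X j)).comap (entry i j)
  comp_mem r f l hf := by
    simp only [AddSubgroup.mem_iInf, AddSubgroup.mem_comap] at hf ⊢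
    intro i j
    rw [entry_comp]
    refine AddSubgroup.sum_mem _ fun k _ => I.comp_mem_left _ ?_
    rw [entry_comp]
    exact AddSubgroup.sum_mem _ fun k' _ => I.comp_mem_right _ (hf _ _)

lemma mem_matIdeal {I : CatIdeal A} {M N : Mat_ A} {f : M ⟶ N} :
    f ∈ (matIdeal I).carrier M N ↔ ∀ i j, entry i j f ∈ I.carrier (M.X i) (N.X j) := by
  simp [matIdeal, AddSubgroup.mem_iInf]

lemma resIdeal_matIdeal (I : CatIdeal A) : resIdeal (matIdeal I) = I :=
  CatIdeal.ext_of_mem fun a b f => by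
    rw [mem_resIdeal, mem_matIdeal]
    exact ⟨fun h => h PUnit.unit PUnit.unit, fun h _ _ => h⟩

/-- Entries arise by composing with inclusions and projections of components, and a matrix is the
sum of its entries composed back. -/
lemma CatIdeal.mem_iff_entry {J : CatIdeal (Mat_ A)} {M N : Mat_ A} {f : M ⟶ N} :
    f ∈ J.carrier M N ↔ ∀ i j, entry i j f ∈ (resIdeal J).carrier (M.X i) (N.X j) := by
  refine ⟨fun h i j => ?_, fun h => ?_⟩
  · have := J.comp_mem (matInj M i) f (matProj N j) h
    rwa [matInj_comp_matProj] at this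
  · rw [eq_sum_embEntry f]
    exact AddSubgroup.sum_mem _ fun i _ => AddSubgroup.sum_mem _ fun j _ =>
      J.comp_mem _ _ _ (h i j)

lemma resIdeal_injective : Function.Injective (resIdeal (A := A)) := fun J J' h =>
  CatIdeal.ext_of_mem fun M N f => by
    rw [CatIdeal.mem_iff_entry, h, ← CatIdeal.mem_iff_entry]

/-- Writing ε = ε ≫ ε splits each generator γ ≫ ε ≫ δ into two factors in the ideal. -/
lemma CatIdeal.isIdempotent_span {C : Type*} [Category* C] [Preadditive C]
    {E : ∀ x : C, Set (x ⟶ x)} (hE : ∀ x, ∀ ε ∈ E x, ε ≫ ε = ε) : (span E).IsIdempotent := by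
  refine isIdempotent_of_le fun a b => (AddSubgroup.closure_le _).2 ?_
  rintro _ ⟨x, ε, γ, δ, hε, rfl⟩
  have h : γ ≫ ε ≫ δ = (γ ≫ ε ≫ 𝟙 x) ≫ (𝟙 x ≫ ε ≫ δ) := by
    simp [reassoc_of% hE x ε hε]
  rw [h]
  exact comp_mem_mul _ (AddSubgroup.subset_closure ⟨x, ε, γ, 𝟙 x, hε, rfl⟩)
    (AddSubgroup.subset_closure ⟨x, ε, 𝟙 x, δ, hε, rfl⟩)

namespace DualBasis

variable {P : RMod A} {ι : Type} [Fintype ι] (β : DualBasis P ι)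

/-- The tuple of objects underlying a dual basis. -/
def tuple : Mat_ A := ⟨ι, β.obj⟩

/-- The idempotent matrix of a dual basis. -/
def idem : β.tuple ⟶ β.tuple := ofEntries fun i j => ev (β.coord j) _ (β.gen i)

/-- The coordinates of an element. -/
def coords {a : A} (x : Elt P a) : (Mat_.embedding A).obj a ⟶ β.tuple :=
  ofEntries fun _ i => ev (β.coord i) a x

/-- The matrix of a linear form. -/
def form {b : A} (f : P ⟶ representable b) : β.tuple ⟶ (Mat_.embedding A).obj b :=
  ofEntries fun i _ => ev f _ (β.gen i)

/-- This is the dual basis expansion of c_k(g_i). -/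
lemma idem_comp_idem : β.idem ≫ β.idem = β.idem :=
  mat_hom_ext fun i k => (β.ev_eq_sum (β.coord k) (β.gen i)).symm

lemma coords_comp_idem {a : A} (x : Elt P a) : β.coords x ≫ β.idem = β.coords x :=
  mat_hom_ext fun _ k => (β.ev_eq_sum (β.coord k) x).symm

lemma coords_comp_form {a b : A} (x : Elt P a) (f : P ⟶ representable b) :
    β.coords x ≫ β.form f = (Mat_.embedding A).map (ev f a x) :=
  mat_hom_ext fun _ _ => (β.ev_eq_sum f x).symm

lemma idem_mem {S : ObjectProperty (RMod A)} (hP : S P) :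
    β.idem ∈ (matIdeal (traceIdeal S)).carrier _ _ :=
  mem_matIdeal.2 fun i j => β.coord_mem hP j (β.gen i)

end DualBasis

end Matrices

/-! ### The Cauchy completion and its modules. -/

section Cauchy

open Idempotents

/-- The embedding of `A` into its Cauchy completion. -/
abbrev toCauchy (A : Type u) [SmallCategory A] [Preadditive A] : A ⥤ CauchyCompletion A :=
  Mat_.embedding A ⋙ toKaroubi (AdditiveClosure A)

/-- The preimage under the embedding into the Cauchy completion. -/
def ofCauchy {a b : A} : ((toCauchy A).obj a ⟶ (toCauchy A).obj b) →+ (a ⟶ b) where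
  toFun f := entry (M := (Mat_.embedding A).obj a) (N := (Mat_.embedding A).obj b)
    PUnit.unit PUnit.unit f.f
  map_zero' := rfl
  map_add' _ _ := rfl

@[simp]
lemma map_ofCauchy {a b : A} (f : (toCauchy A).obj a ⟶ (toCauchy A).obj b) :
    (toCauchy A).map (ofCauchy f) = f := rfl

@[simp]
lemma ofCauchy_map {a b : A} (r : a ⟶ b) : ofCauchy ((toCauchy A).map r) = r := rfl

lemma ofCauchy_map_comp {a b c : A} (r : a ⟶ b) (g : (toCauchy A).obj b ⟶ (toCauchy A).obj c) :
    ofCauchy ((toCauchy A).map r ≫ g) = r ≫ ofCauchy g := by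
  conv_lhs => rw [← map_ofCauchy g, ← Functor.map_comp, ofCauchy_map]

/-- The linear form on the module of `Q` given by a morphism from `Q`. -/
def cauchyForm {Q : CauchyCompletion A} {b : A} (δ : Q ⟶ (toCauchy A).obj b) :
    cauchyModule Q ⟶ representable b :=
  homOfEv (fun a => ofCauchy.comp (Preadditive.rightComp ((toCauchy A).obj a) δ)) fun {_ b'} r x =>
      (congrArg ofCauchy (Category.assoc ((toCauchy A).map r)
        (show (toCauchy A).obj b' ⟶ Q from x) δ)).trans (ofCauchy_map_comp r _)

/-- The canonical generators of an object of the Cauchy completion. -/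
def cauchyGen (Q : CauchyCompletion A) (i : Q.X.ι) : (toCauchy A).obj (Q.X.X i) ⟶ Q where
  f := matInj Q.X i ≫ Q.p
  comm := by simp

/-- The canonical coordinates on an object of the Cauchy completion. -/
def cauchyCoord (Q : CauchyCompletion A) (i : Q.X.ι) : Q ⟶ (toCauchy A).obj (Q.X.X i) where
  f := Q.p ≫ matProj Q.X i
  comm := by simp

lemma sum_cauchyCoord_comp_cauchyGen (Q : CauchyCompletion A) :
    ∑ i, cauchyCoord Q i ≫ cauchyGen Q i = 𝟙 Q := by
  ext1
  rw [Karoubi.sum_hom, Karoubi.id_f]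
  have h (i : Q.X.ι) : (cauchyCoord Q i ≫ cauchyGen Q i).f = Q.p ≫ (matProj Q.X i ≫ matInj Q.X i) ≫ Q.p := by
    simp [cauchyCoord, cauchyGen]
  simp_rw [h]
  rw [← Preadditive.comp_sum, ← Preadditive.sum_comp, sum_matProj_comp_matInj, Category.id_comp,
    Q.idem]

lemma cauchyGen_comp_cauchyCoord (Q : CauchyCompletion A) (i j : Q.X.ι) :
    cauchyGen Q i ≫ cauchyCoord Q j = (toCauchy A).map (entry i j Q.p) := by
  ext1
  have := matInj_comp_matProj Q.p i j
  simpa [cauchyCoord, cauchyGen, embEntry] using this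

/-- The canonical dual basis of the module of an object of the Cauchy completion. -/
def cauchyDualBasis (Q : CauchyCompletion A) : DualBasis (cauchyModule Q) Q.X.ι where
  obj := Q.X.X
  gen := cauchyGen Q
  coord i := cauchyForm (cauchyCoord Q i)
  eq_sum {b} x := by
    change ((toCauchy A).obj b ⟶ Q) at x
    change x = ∑ i, (x ≫ cauchyCoord Q i) ≫ cauchyGen Q i
    simp_rw [Category.assoc]
    rw [← Preadditive.comp_sum, sum_cauchyCoord_comp_cauchyGen, Category.comp_id]

lemma cauchyModules_le (X : ObjectProperty (CauchyCompletion A)) (P : RMod A)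
    (hP : cauchyModules X P) : IsFinGenProj P := by
  obtain ⟨Q, -, rfl⟩ := hP
  exact (cauchyDualBasis Q).isFinGenProj

lemma mem_traceIdeal_cauchyModules {X : ObjectProperty (CauchyCompletion A)}
    {Q : CauchyCompletion A} (hQ : X Q) {a b : A} (γ : (toCauchy A).obj a ⟶ Q)
    (δ : Q ⟶ (toCauchy A).obj b) : ofCauchy (γ ≫ δ) ∈ (traceIdeal (cauchyModules X)).carrier a b :=
  ev_mem_traceIdeal ⟨Q, hQ, rfl⟩ (cauchyForm δ) γ

/-- An arbitrary linear form on the module of Q need not be given as a morphism out of Q. The dual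
basis rewrites its values as sums of composites through Q, so testing these composites suffices. -/
lemma map_mem_of_mem_traceIdeal {X : ObjectProperty (CauchyCompletion A)} {a b : A}
    {U : AddSubgroup ((toCauchy A).obj a ⟶ (toCauchy A).obj b)}
    (hU : ∀ Q, X Q → ∀ (γ : (toCauchy A).obj a ⟶ Q) (δ : Q ⟶ (toCauchy A).obj b), γ ≫ δ ∈ U)
    {r : a ⟶ b} (hr : r ∈ (traceIdeal (cauchyModules X)).carrier a b) :
    (toCauchy A).map r ∈ U := by
  suffices h : (traceIdeal (cauchyModules X)).carrier a b ≤ U.comap (toCauchy A).mapAddHom from h hr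
  refine traceIdeal_le ?_
  rintro _ ⟨Q, hQ, rfl⟩ f x
  rw [(cauchyDualBasis Q).ev_eq_sum f x]
  refine AddSubgroup.sum_mem _ fun i _ => ?_
  have e (y : (toCauchy A).obj a ⟶ Q) (t : Q.X.X i ⟶ b) :
      (toCauchy A).map (ofCauchy (y ≫ cauchyCoord Q i) ≫ t) ∈ U := by
    rw [Functor.map_comp, map_ofCauchy, Category.assoc]
    exact hU Q hQ _ _
  exact e x _

/-- The object of the Cauchy completion given by a dual basis. -/
def DualBasis.karoubi {P : RMod A} {ι : Type} [Fintype ι] (β : DualBasis P ι) :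
    CauchyCompletion A := ⟨β.tuple, β.idem, β.idem_comp_idem⟩

lemma DualBasis.ev_mem_traceIdeal_cauchyModules {X : ObjectProperty (CauchyCompletion A)}
    {P : RMod A} {ι : Type} [Fintype ι] (β : DualBasis P ι) (hβ : X β.karoubi) {a b : A}
    (x : Elt P a) (f : P ⟶ representable b) :
    ev f a x ∈ (traceIdeal (cauchyModules X)).carrier a b := by
  let γ : (toCauchy A).obj a ⟶ β.karoubi := ⟨β.coords x, by
    simp [DualBasis.karoubi, β.coords_comp_idem]⟩
  let δ : β.karoubi ⟶ (toCauchy A).obj b := ⟨β.idem ≫ β.form f, by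
    simp [DualBasis.karoubi, reassoc_of% β.idem_comp_idem]⟩
  have h : γ ≫ δ = (toCauchy A).map (ev f a x) := by
    ext1
    change β.coords x ≫ β.idem ≫ β.form f = _
    rw [← Category.assoc, β.coords_comp_idem, β.coords_comp_form]
    rfl
  have h' : ofCauchy (γ ≫ δ) = ev f a x := congrArg ofCauchy h
  exact h' ▸ mem_traceIdeal_cauchyModules hβ γ δ

end Cauchy

/-! ### Idempotent-generated ideals: the correspondence (4)-(3). -/

section AdditiveClosureIdeals

open Idempotents

/-- The objects of the Cauchy completion given by a set of idempotents. -/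
def idempotentObjects (E : ∀ x : Mat_ A, Set (x ⟶ x)) : ObjectProperty (CauchyCompletion A) :=
  fun Q => Q.p ∈ E Q.X

/-- A composite γ ≫ ε ≫ δ with ε idempotent on x is a composite through the object (x, ε) of the
Cauchy completion, and conversely. -/
lemma resIdeal_span {E : ∀ x : Mat_ A, Set (x ⟶ x)} (hE : ∀ x, ∀ ε ∈ E x, ε ≫ ε = ε) :
    resIdeal (CatIdeal.span E) = traceIdeal (cauchyModules (idempotentObjects E)) := by
  refine CatIdeal.ext_of_mem fun a b r => ⟨fun h => ?_, fun h => ?_⟩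
  · let down : ((Mat_.embedding A).obj a ⟶ (Mat_.embedding A).obj b) →+ (a ⟶ b) :=
      entry PUnit.unit PUnit.unit
    suffices hle : (CatIdeal.span E).carrier _ _ ≤
        ((traceIdeal (cauchyModules (idempotentObjects E))).carrier a b).comap down from hle h
    refine (AddSubgroup.closure_le _).2 ?_
    rintro _ ⟨x, ε, γ, δ, hε, rfl⟩
    have hi := hE x ε hε
    let Q : CauchyCompletion A := ⟨x, ε, hi⟩
    let γ' : (toCauchy A).obj a ⟶ Q := ⟨γ ≫ ε, by simp [Q, hi]⟩
    let δ' : Q ⟶ (toCauchy A).obj b := ⟨ε ≫ δ, by simp [Q, reassoc_of% hi]⟩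
    have h' : ofCauchy (γ' ≫ δ') = down (γ ≫ ε ≫ δ) := by
      change down ((γ ≫ ε) ≫ ε ≫ δ) = _
      rw [Category.assoc, reassoc_of% hi]
    have hQ : idempotentObjects E Q := hε
    change down (γ ≫ ε ≫ δ) ∈ (traceIdeal (cauchyModules (idempotentObjects E))).carrier a b
    exact h' ▸ mem_traceIdeal_cauchyModules hQ γ' δ'
  · refine map_mem_of_mem_traceIdeal (U := ((CatIdeal.span E).carrier _ _).comap
      (Karoubi.inclusionHom _ _)) (fun Q hQ γ δ => ?_) h
    change γ.f ≫ δ.f ∈ (CatIdeal.span E).carrier _ _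
    rw [← Karoubi.p_comp δ]
    exact AddSubgroup.subset_closure ⟨_, _, _, _, hQ, rfl⟩

/-- Restriction of ideals from the additive closure. -/
def restrictIdeals (J : IdempotentGeneratedIdeals A) : FgpTraceIdeals A :=
  ⟨resIdeal J.1, by
    obtain ⟨J, -, E, hE, rfl⟩ := J
    rw [resIdeal_span hE]
    exact ⟨isIdempotent_traceIdeal (cauchyModules_le _), isFgpTrace_traceIdeal (cauchyModules_le _)⟩⟩

lemma isFinGenProj_of_ofObj {ι : Type*} {P : ι → RMod A} (hP : ∀ i, IsFinGenProj (P i))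
    (M : RMod A) (hM : ObjectProperty.ofObj P M) : IsFinGenProj M := by
  obtain ⟨i⟩ := hM
  exact hP i

/-- The value of a linear form g at x is the matrix product of the coordinates of x, the idempotent
of the dual basis and the matrix of g. That idempotent lies in the ideal, so taking all idempotents
of the ideal as generators is enough. -/
lemma matIdeal_traceIdeal_eq_span {S : ObjectProperty (RMod A)}
    (hS : ∀ P, S P → IsFinGenProj P) : matIdeal (traceIdeal S) = CatIdeal.span
      (fun x => {ε : x ⟶ x | ε ≫ ε = ε ∧ ε ∈ (matIdeal (traceIdeal S)).carrier x x}) := by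
  refine CatIdeal.ext_of_mem fun M N f => ⟨fun h => ?_, fun h => ?_⟩
  · rw [CatIdeal.mem_iff_entry]
    intro i j
    refine traceIdeal_le (fun P hP g x => ?_) (mem_matIdeal.1 h i j)
    obtain ⟨n, ⟨β⟩⟩ := (hS P hP).exists_dualBasis
    refine mem_resIdeal.2 ?_
    have h1 := β.coords_comp_form x g
    rw [← β.coords_comp_idem, Category.assoc] at h1
    exact h1 ▸ AddSubgroup.subset_closure ⟨_, _, _, _, ⟨β.idem_comp_idem, β.idem_mem hP⟩, rfl⟩
  · refine (AddSubgroup.closure_le _).2 ?_ h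
    rintro _ ⟨x, ε, γ, δ, ⟨-, hε⟩, rfl⟩
    exact CatIdeal.comp_mem _ _ _ _ hε

lemma restrictIdeals_bijective : Function.Bijective (restrictIdeals (A := A)) := by
  refine ⟨fun J J' h => Subtype.ext (resIdeal_injective (congrArg Subtype.val h)), ?_⟩
  rintro ⟨_, -, ι, P, hP, rfl⟩
  have h := matIdeal_traceIdeal_eq_span (isFinGenProj_of_ofObj hP)
  refine ⟨⟨matIdeal (traceIdeal (ObjectProperty.ofObj P)), ?_, _, fun x ε hε => hε.1, h⟩,
    Subtype.ext (resIdeal_matIdeal _)⟩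
  rw [h]
  exact CatIdeal.isIdempotent_span fun x ε hε => hε.1

end AdditiveClosureIdeals

/-! ### Subcategories of the Cauchy completion: the correspondence (5)-(3). -/

section CauchySubcategoriesIdeals

open Idempotents Limits

/-- The trace of a class of objects of the Cauchy completion. -/
def traceOfSubcategory (X : CauchySubcategories A) : FgpTraceIdeals A :=
  ⟨traceIdeal (cauchyModules X.1),
    isIdempotent_traceIdeal (cauchyModules_le _), isFgpTrace_traceIdeal (cauchyModules_le _)⟩

/-- The objects of the Cauchy completion whose identity belongs to an ideal. -/
def idealObjects (I : CatIdeal A) : ObjectProperty (CauchyCompletion A) :=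
  fun Q => Q.p ∈ (matIdeal I).carrier Q.X Q.X

/-- The morphisms that factor through an object of a class closed under finite coproducts. -/
def factorsThrough {C : Type*} [Category* C] [Preadditive C] [HasFiniteBiproducts C]
    (X : ObjectProperty C) [X.IsClosedUnderFiniteCoproducts] (a b : C) : AddSubgroup (a ⟶ b) where
  carrier := {f | ∃ (c : C) (_ : X c) (γ : a ⟶ c) (δ : c ⟶ b), γ ≫ δ = f}
  zero_mem' := ⟨⊥_ C, X.prop_of_isColimit (F := Functor.empty C) (colimit.isColimit _)
    (by rintro ⟨⟨⟩⟩), 0, 0, by simp⟩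
  add_mem' := by
    have : HasBinaryBiproducts C := hasBinaryBiproducts_of_finite_biproducts C
    rintro _ _ ⟨c, hc, γ, δ, rfl⟩ ⟨c', hc', γ', δ', rfl⟩
    exact ⟨c ⊞ c', X.prop_of_isColimit_binaryCofan (BinaryBiproduct.isColimit c c') hc hc',
      biprod.lift γ γ', biprod.desc δ δ', biprod.lift_desc⟩
  neg_mem' := by
    rintro _ ⟨c, hc, γ, δ, rfl⟩
    exact ⟨c, hc, γ, -δ, by simp⟩

/-- The identity of Q is the sum over i, j of coordinate i, the entry p_ij and generator j. If every
p_ij is in the trace, each summand factors through `X`; finite coproducts make the sum factor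
through a single object of `X`, and Q is a retract of it. -/
lemma eq_idealObjects (X : ObjectProperty (CauchyCompletion A)) [X.IsClosedUnderFiniteCoproducts]
    [X.IsStableUnderRetracts] : X = idealObjects (traceIdeal (cauchyModules X)) := by
  ext Q
  refine ⟨fun hQ => mem_matIdeal.2 fun i j => ?_, fun hQ => ?_⟩
  · have := mem_traceIdeal_cauchyModules hQ (cauchyGen Q i) (cauchyCoord Q j)
    rwa [cauchyGen_comp_cauchyCoord, ofCauchy_map] at this
  · have h : 𝟙 Q ∈ factorsThrough X Q Q := by
      rw [← Category.id_comp (𝟙 Q), ← sum_cauchyCoord_comp_cauchyGen, Preadditive.sum_comp]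
      simp_rw [Preadditive.comp_sum]
      refine AddSubgroup.sum_mem _ fun i _ => AddSubgroup.sum_mem _ fun j _ => ?_
      rw [Category.assoc, reassoc_of% cauchyGen_comp_cauchyCoord]
      obtain ⟨c, hc, γ, δ, h⟩ := map_mem_of_mem_traceIdeal
        (U := factorsThrough X _ _) (fun Q' hQ' γ δ => ⟨Q', hQ', γ, δ, rfl⟩) (mem_matIdeal.1 hQ i j)
      exact ⟨c, hc, cauchyCoord Q i ≫ γ, δ ≫ cauchyGen Q j, by
        rw [Category.assoc, reassoc_of% h]⟩
    obtain ⟨c, hc, γ, δ, h⟩ := h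
    exact X.prop_of_retract ⟨γ, δ, h⟩ hc

instance (I : CatIdeal A) : (idealObjects I).IsStableUnderRetracts where
  of_retract {Q Q'} ρ h := by
    have := (matIdeal I).comp_mem ρ.i.f Q'.p ρ.r.f h
    rw [Karoubi.p_comp] at this
    have e : ρ.i.f ≫ ρ.r.f = Q.p := congrArg Karoubi.Hom.f ρ.retract
    rwa [e] at this

instance (I : CatIdeal A) : (idealObjects I).IsClosedUnderFiniteCoproducts where
  isClosedUnderColimitsOfShape J _ := ⟨by
    rintro Q ⟨h⟩
    have := Fintype.ofFinite J
    classical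
    let F : J → CauchyCompletion A := fun j => h.diag.obj ⟨j⟩
    let e : Discrete.functor F ≅ h.diag := Discrete.natIso fun j => Iso.refl _
    let hc := (IsColimit.precomposeHomEquiv e _).symm h.isColimit
    have ht := IsBilimit.total (biconeIsBilimitOfColimitCoconeOfIsColimit hc)
    have ht' := congrArg Karoubi.Hom.f ht
    rw [Karoubi.sum_hom] at ht'
    change Q.p ∈ _
    change _ = Q.p at ht'
    rw [← ht']
    refine AddSubgroup.sum_mem _ fun j _ => ?_
    -- Inserting the idempotent of the j-th object, which lies in the ideal by assumption, puts the
    -- j-th summand in the ideal.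
    rw [Karoubi.comp_f, ← Karoubi.p_comp]
    exact (matIdeal I).comp_mem _ _ _ (h.prop_diag_obj ⟨j⟩)⟩

lemma traceIdeal_idealObjects {S : ObjectProperty (RMod A)} (hS : ∀ P, S P → IsFinGenProj P) :
    traceIdeal (cauchyModules (idealObjects (traceIdeal S))) = traceIdeal S := by
  refine CatIdeal.ext_of_mem fun a b r => ⟨fun h => ?_, fun h => ?_⟩
  · refine traceIdeal_le ?_ h
    rintro _ ⟨Q, hQ, rfl⟩ f x
    have hx : ((show (toCauchy A).obj a ⟶ Q from x)).f ∈ (matIdeal (traceIdeal S)).carrier _ _ := by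
      rw [← Karoubi.comp_p]
      exact (matIdeal (traceIdeal S)).comp_mem_left _ hQ
    rw [(cauchyDualBasis Q).ev_eq_sum f x]
    refine AddSubgroup.sum_mem _ fun i _ => (traceIdeal S).comp_mem_right _ ?_
    have : ((show (toCauchy A).obj a ⟶ Q from x) ≫ cauchyCoord Q i).f ∈
      (matIdeal (traceIdeal S)).carrier _ _ := CatIdeal.comp_mem_right _ _ hx
    exact mem_matIdeal.1 this PUnit.unit PUnit.unit
  · refine traceIdeal_le (fun P hP f x => ?_) h
    obtain ⟨n, ⟨β⟩⟩ := (hS P hP).exists_dualBasis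
    exact β.ev_mem_traceIdeal_cauchyModules (β.idem_mem hP) x f

lemma traceOfSubcategory_bijective : Function.Bijective (traceOfSubcategory (A := A)) := by
  refine ⟨?_, ?_⟩
  · rintro ⟨X, hX, hX'⟩ ⟨Y, hY, hY'⟩ h
    have h' : traceIdeal (cauchyModules X) = traceIdeal (cauchyModules Y) := congrArg Subtype.val h
    refine Subtype.ext ?_
    change X = Y
    rw [eq_idealObjects X, h', ← eq_idealObjects Y]
  · rintro ⟨_, -, ι, P, hP, rfl⟩
    exact ⟨⟨idealObjects (traceIdeal (ObjectProperty.ofObj P)), inferInstance, inferInstance⟩,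
      Subtype.ext (traceIdeal_idealObjects (isFinGenProj_of_ofObj hP))⟩

end CauchySubcategoriesIdeals

end AdditiveClosures

open Limits

/-! ### Kernels of adjoint functors as orthogonal classes. -/

section Adjunctions

variable {C D : Type*} [Category* C] [Category* D] [Preadditive C] [Preadditive D]
  {L : C ⥤ D} {G : D ⥤ C}

/-- The unit M ⟶ G L M is the transpose of the identity of L M and has target in the image of G; if
it vanishes, so does L M. -/
lemma kernel_eq_leftOrthogonal [G.PreservesZeroMorphisms] (adj : L ⊣ G) :
    L.kernel = G.essImage.leftOrthogonal := by
  ext M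
  refine ⟨fun hM N f ⟨Y, ⟨e⟩⟩ => ?_, fun hM => ?_⟩
  · have h : f ≫ e.inv = 0 := (adj.homEquiv M Y).symm.injective (IsZero.eq_of_src hM _ _)
    rw [← cancel_mono e.inv, h, zero_comp]
  · refine (IsZero.iff_id_eq_zero _).2 ((adj.homEquiv _ _).injective ?_)
    have h := hM (adj.unit.app M) (G.obj_mem_essImage _)
    rw [adj.homEquiv_unit, adj.homEquiv_unit, h, zero_comp, zero_comp]

lemma kernel_eq_rightOrthogonal [L.PreservesZeroMorphisms] (adj : L ⊣ G) :
    G.kernel = L.essImage.rightOrthogonal := by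
  ext M
  refine ⟨fun hM N f ⟨Y, ⟨e⟩⟩ => ?_, fun hM => ?_⟩
  · have h : e.hom ≫ f = 0 := (adj.homEquiv Y M).injective (IsZero.eq_of_tgt hM _ _)
    rw [← cancel_epi e.hom, h, comp_zero]
  · refine (IsZero.iff_id_eq_zero _).2 ((adj.homEquiv _ _).symm.injective ?_)
    have h := hM (adj.counit.app M) (L.obj_mem_essImage _)
    rw [adj.homEquiv_counit, adj.homEquiv_counit, h, comp_zero, comp_zero]

omit [Preadditive D] in
lemma kernel_isClosedUnderLimitsOfShape {J : Type*} [Category* J] (F : D ⥤ C)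
    [PreservesLimitsOfShape J F] : F.kernel.IsClosedUnderLimitsOfShape J where
  limitsOfShape_le := by
    rintro M ⟨h⟩
    refine (IsZero.iff_id_eq_zero _).2 ((isLimitOfPreserves F h.isLimit).hom_ext fun j => ?_)
    exact (h.prop_diag_obj j).eq_of_tgt _ _

end Adjunctions

/-! ### Exact functors and morphisms they invert. -/

section ExactFunctors

variable {C D E : Type*} [Category* C] [Category* D] [Category* E] [Abelian C] [Abelian D]
  [Abelian E] (F : C ⥤ D) (G : C ⥤ E) [PreservesFiniteLimits F] [PreservesFiniteColimits F]
  [F.PreservesZeroMorphisms] [PreservesFiniteLimits G] [PreservesFiniteColimits G]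
  [G.PreservesZeroMorphisms]

/-- F kills the kernel and cokernel of f, hence G does too, and exactness of G makes G f mono and
epi. -/
lemma isIso_map_of_isIso_map_of_kernel_le (h : F.kernel ≤ G.kernel) {M N : C} (f : M ⟶ N)
    [IsIso (F.map f)] : IsIso (G.map f) := by
  have : Mono (G.map f) := by
    have h0 : IsZero (G.obj (kernel f)) := h _
      (IsZero.of_iso (isZero_kernel_of_mono (F.map f)) (PreservesKernel.iso F f))
    exact Preadditive.mono_of_isZero_kernel _ (h0.of_iso (PreservesKernel.iso G f).symm)
  have : Epi (G.map f) := by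
    have h0 : IsZero (G.obj (cokernel f)) := h _
      (IsZero.of_iso (isZero_cokernel_of_epi (F.map f)) (PreservesCokernel.iso F f))
    exact Preadditive.epi_of_isZero_cokernel _ (h0.of_iso (PreservesCokernel.iso G f).symm)
  exact isIso_of_mono_of_epi _

end ExactFunctors

/-! ### From recollements to TTF triples, injectively. -/

section RecollementTTF

variable {A : Type u} [SmallCategory A] [Preadditive A]

lemma TTFTriple.eq_of_T_eq {D : Type (u + 1)} [Category.{u} D] [Preadditive D]
    {τ τ' : TTFTriple D} (h : τ.T = τ'.T) : τ = τ' := by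
  ext1
  · rw [τ.eq_left, τ'.eq_left, h]
  · exact h
  · rw [τ.isTorsionPair.eq_right, τ'.isTorsionPair.eq_right, h]

/-- The torsion part of X is the kernel of the unit X ⟶ H F X. The quotient embeds in H F X, and
morphisms T ⟶ H F X correspond to morphisms F T ⟶ F X, which vanish for T in the kernel of F. -/
lemma isTorsionPair_kernel {D E : Type*} [Category* D] [Category* E] [Abelian D] [Abelian E]
    {F : D ⥤ E} {H : E ⥤ D} [F.PreservesZeroMorphisms] [PreservesFiniteLimits F] (adj : F ⊣ H) :
    IsTorsionPair F.kernel F.kernel.rightOrthogonal := by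
  have h (X : D) : ∃ (TX FX : D) (i : TX ⟶ X) (p : X ⟶ FX) (w : i ≫ p = 0),
      F.kernel TX ∧ F.kernel.rightOrthogonal FX ∧ (ShortComplex.mk i p w).ShortExact := by
    let η := adj.unit.app X
    refine ⟨kernel η, cokernel (kernel.ι η), kernel.ι η, cokernel.π _, cokernel.condition _,
      ?_, ?_, ?_⟩
    · have h1 : F.map η ≫ adj.counit.app (F.obj X) = 𝟙 _ := adj.left_triangle_components X
      have h2 : F.map (kernel.ι η) = 0 := by
        rw [← Category.comp_id (F.map (kernel.ι η)), ← h1, ← Category.assoc, ← F.map_comp,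
          kernel.condition, F.map_zero, zero_comp]
      -- Left exactness keeps the kernel inclusion mono under F; being also zero, it has zero
      -- source.
      exact (IsZero.iff_id_eq_zero _).2 (by rw [← cancel_mono (F.map (kernel.ι η)), h2]; simp)
    · intro T f hT
      rw [← cancel_mono (Abelian.factorThruCoimage η), zero_comp]
      exact (adj.homEquiv _ _).symm.injective (hT.eq_of_src _ _)
    · exact { exact := ShortComplex.exact_cokernel (kernel.ι η) }
  refine ⟨?_, rfl, h⟩
  ext X
  refine ⟨fun hX Y f hY => hY f hX, fun hX => ?_⟩
  obtain ⟨TX, FX, i, p, w, hT, hF, hS⟩ := h X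
  have hp : p = 0 := hX p hF
  have : Mono i := hS.mono_f
  have : Epi i := hS.exact.epi_f hp
  have : IsIso i := isIso_of_mono_of_epi i
  exact F.kernel.prop_of_iso (asIso i) hT

namespace Recollement

attribute [local instance] additive_iLowerStar additive_jUpperStar full_jLowerShriek
  faithful_jLowerShriek

variable (R : Recollement (RMod A))

instance : PreservesLimitsOfSize.{0, 0} R.jUpperStar := R.adj_j₁.rightAdjoint_preservesLimits

instance : PreservesColimitsOfSize.{0, 0} R.jUpperStar := R.adj_j₂.leftAdjoint_preservesColimits

/-- The TTF triple of a recollement. -/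
def ttf : TTFTriple (RMod A) where
  C := R.iUpperStar.kernel
  T := R.iLowerStar.essImage
  F := R.iUpperShriek.kernel
  isTorsionPair := by
    rw [kernel_eq_rightOrthogonal R.adj_i₂, R.image_eq_kernel]
    exact isTorsionPair_kernel R.adj_j₂
  hereditary := by
    rw [R.image_eq_kernel]
    infer_instance
  products J := by
    rw [R.image_eq_kernel]
    have : PreservesLimitsOfSize.{u, u} R.jUpperStar := R.adj_j₁.rightAdjoint_preservesLimits
    exact kernel_isClosedUnderLimitsOfShape _
  eq_left := kernel_eq_leftOrthogonal R.adj_i₁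

variable {R} in
lemma Equiv.ttf_eq {R' : Recollement (RMod A)} (h : R.Equiv R') : R.ttf = R'.ttf := by
  obtain ⟨Ψ, ⟨α⟩⟩ := h
  refine TTFTriple.eq_of_T_eq ?_
  change R.iLowerStar.essImage = R'.iLowerStar.essImage
  rw [R.image_eq_kernel, R'.image_eq_kernel]
  ext M
  refine ⟨fun h => ?_, fun h => ?_⟩
  · exact IsZero.of_iso (Ψ.functor.map_isZero h) (α.app M).symm
  · have h' : IsZero (Ψ.functor.obj (R.jUpperStar.obj M)) := IsZero.of_iso h (α.app M)
    exact IsZero.of_iso (Ψ.inverse.map_isZero h') (Ψ.unitIso.app _)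

/-- The comparison of the right-hand functors of two recollements with the same kernel. -/
def comparisonIso (R' : Recollement (RMod A)) (h : R.jUpperStar.kernel ≤ R'.jUpperStar.kernel) :
    R.jUpperStar ⋙ R.jLowerShriek ⋙ R'.jUpperStar ≅ R'.jUpperStar :=
  -- Since j_! is fully faithful, j^* inverts the counit j_! j^* M ⟶ M; by exactness and the
  -- inclusion of kernels, so does the other j^*.
  have (M : RMod A) : IsIso (R'.jUpperStar.map (R.adj_j₁.counit.app M)) :=
    isIso_map_of_isIso_map_of_kernel_le R.jUpperStar _ h _
  NatIso.ofComponents (fun M => asIso (R'.jUpperStar.map (R.adj_j₁.counit.app M)))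
    fun {M N} f => by
      have := R.adj_j₁.counit.naturality f
      simp only [Functor.comp_map, asIso_hom, ← Functor.map_comp]
      exact congrArg _ this

lemma equiv_of_kernel_eq {R' : Recollement (RMod A)}
    (h : R.jUpperStar.kernel = R'.jUpperStar.kernel) : R.Equiv R' := by
  let θ := R.comparisonIso R' h.le
  let θ' := R'.comparisonIso R h.ge
  refine ⟨CategoryTheory.Equivalence.mk (R.jLowerShriek ⋙ R'.jUpperStar)
    (R'.jLowerShriek ⋙ R.jUpperStar) ?_ ?_, ⟨θ⟩⟩
  · exact asIso R.adj_j₁.unit ≪≫ (Functor.isoWhiskerLeft R.jLowerShriek θ').symm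
  · exact Functor.isoWhiskerLeft R'.jLowerShriek θ ≪≫ (asIso R'.adj_j₁.unit).symm

lemma equiv_of_ttf_eq {R' : Recollement (RMod A)} (h : R.ttf = R'.ttf) : R.Equiv R' := by
  have h' : R.iLowerStar.essImage = R'.iLowerStar.essImage := congrArg TTFTriple.T h
  rw [R.image_eq_kernel, R'.image_eq_kernel] at h'
  exact R.equiv_of_kernel_eq h'

end Recollement

end RecollementTTF

/-! ### TTF triples of recollements are generated by projectives. -/

section Generation

variable {A B : Type u} [SmallCategory A] [Preadditive A] [SmallCategory B] [Preadditive B]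

/-- The morphisms that are finite sums of composites through representable modules. -/
def finiteFactorizations (M N : RMod A) : AddSubgroup (M ⟶ N) where
  carrier := {f | ∃ (ι : Type) (_ : Fintype ι) (obj : ι → A) (s : ∀ i, M ⟶ representable (obj i))
    (q : ∀ i, representable (obj i) ⟶ N), f = ∑ i, s i ≫ q i}
  zero_mem' := ⟨Empty, inferInstance, nofun, nofun, nofun, by simp⟩
  add_mem' := by
    rintro _ _ ⟨ι, _, obj, s, q, rfl⟩ ⟨ι', _, obj', s', q', rfl⟩
    exact ⟨ι ⊕ ι', inferInstance, Sum.elim obj obj', fun i => i.rec s s', fun i => i.rec q q',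
      by simp⟩
  neg_mem' := by
    rintro _ ⟨ι, _, obj, s, q, rfl⟩
    exact ⟨ι, inferInstance, obj, s, fun i => - q i, by simp⟩

/-- A left adjoint of an additive functor that preserves colimits sends representable modules
to finitely generated projective ones. -/
lemma isFinGenProj_leftAdjoint_obj {L : RMod B ⥤ RMod A} {G : RMod A ⥤ RMod B}
    {H : RMod B ⥤ RMod A} [G.Additive] (adj : L ⊣ G) (adj' : G ⊣ H) (b : B) :
    IsFinGenProj (L.obj (representable b)) := by
  let P := L.obj (representable b)
  have key (y : Elt (G.obj P) b) :
      (adj.homEquiv _ _).symm (elt y) ∈ finiteFactorizations P P := by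
    have := adj.left_adjoint_additive
    -- The morphisms H_a ⟶ P given by all elements of P are jointly epimorphic, and G, being a left
    -- adjoint, keeps them so. Hence an element of G P is a finite sum of elements from the G H_a.
    -- Applied to the unit, this factors the identity of P through finitely many representables.
    let J := Σ a, Elt P a
    have hy := mem_iSup_range_of_jointly_epi (M := G.obj P) (J := J)
      (fun j => G.map (elt j.2)) (fun N g hg => ?_) y
    · let φ : Elt (G.obj P) b →+ (P ⟶ P) :=
        ((adj.homAddEquiv (representable b) P).symm.toAddMonoidHom).comp
          (eltEquiv (G.obj P) b).toAddMonoidHom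
      suffices hle : (⨆ j : J, (ev (G.map (elt j.2)) b).range) ≤
        (finiteFactorizations P P).comap φ from hle hy
      refine iSup_le fun j => ?_
      rintro _ ⟨z, rfl⟩
      refine ⟨Unit, inferInstance, fun _ => j.1, fun _ => (adj.homEquiv _ _).symm (elt z),
        fun _ => elt j.2, ?_⟩
      simp only [Finset.univ_unique, Finset.sum_singleton]
      rw [← adj.homEquiv_naturality_right_symm, elt_comp]
      rfl
    · apply (adj'.homEquiv _ _).injective
      refine rmod_hom_ext fun a x => ?_
      have h : elt x ≫ adj'.homEquiv _ _ g = elt x ≫ adj'.homEquiv _ _ 0 := by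
        rw [← adj'.homEquiv_naturality_left, ← adj'.homEquiv_naturality_left, hg ⟨a, x⟩, comp_zero]
      rw [elt_comp, elt_comp] at h
      exact (eltEquiv _ a).injective h
  obtain ⟨ι, _, obj, s, q, h⟩ := key (ev (adj.unit.app (representable b)) b (𝟙 b))
  rw [elt_ev_id] at h
  refine (DualBasis.ofIdEqSum obj s q ?_).isFinGenProj
  rw [← h]
  exact (adj.homEquiv_symm_unit _).symm

/-- With L = j_! ∘ e⁻¹ and G = e ∘ j^*, Hom(L H_b, M) is G M evaluated at b, so orthogonality to all
L H_b says exactly j^* M = 0. -/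
lemma Recollement.ttf_isFgpGenerated (R : Recollement (RMod A)) (e : R.X ≌ RMod B) :
    R.ttf.IsFgpGenerated := by
  have := R.additive_jUpperStar
  have : e.functor.Additive := Functor.additive_of_preserves_binary_products _
  let L := e.inverse ⋙ R.jLowerShriek
  let G := R.jUpperStar ⋙ e.functor
  let adj : L ⊣ G := e.symm.toAdjunction.comp R.adj_j₁
  let adj' : G ⊣ e.inverse ⋙ R.jLowerStar := R.adj_j₂.comp e.toAdjunction
  refine ⟨B, fun b => L.obj (representable b),
    fun b => isFinGenProj_leftAdjoint_obj adj adj' b, ?_⟩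
  change R.iLowerStar.essImage = _
  rw [R.image_eq_kernel]
  ext M
  have h : IsZero (R.jUpperStar.obj M) ↔ IsZero (G.obj M) :=
    ⟨fun h => e.functor.map_isZero h,
      fun h => IsZero.of_iso (e.inverse.map_isZero h) (e.unitIso.app _)⟩
  refine h.trans ⟨?_, fun hM => (isZero_iff_elt _).2 fun b x => ?_⟩
  · rintro hM _ f ⟨b⟩
    exact (adj.homEquiv _ _).injective (hM.eq_of_tgt _ _)
  · apply (eltEquiv _ b).injective
    apply (adj.homEquiv _ _).symm.injective
    rw [hM ((adj.homEquiv _ _).symm (eltEquiv _ b x)) (ObjectProperty.ofObj_apply _ b),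
      hM ((adj.homEquiv _ _).symm (eltEquiv _ b 0)) (ObjectProperty.ofObj_apply _ b)]

end Generation

/-! ### The functor M ↦ Hom(G -, M) and its two adjoints. -/

section RestrictedYoneda

variable {A B : Type u} [SmallCategory A] [Preadditive A] [SmallCategory B] [Preadditive B]
  (G : B ⥤ RMod A) [G.Additive]

/-- The functor sending an `A`-module `M` to the `B`-module `b ↦ Hom(G b, M)`. -/
def restrictedYoneda : RMod A ⥤ RMod B where
  obj M := moduleOfAct (fun b => G.obj b ⟶ M) (fun r => Preadditive.leftComp M (G.map r))
    (fun b f => by simp [Preadditive.leftComp]) (fun r t f => by simp [Preadditive.leftComp])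
    (fun r t f => by simp [Preadditive.leftComp, Functor.map_add])
  map φ := homOfEv (fun b => Preadditive.rightComp (G.obj b) φ) fun r x =>
    Category.assoc (G.map r) x φ
  map_id M := rmod_hom_ext fun b f => Category.comp_id (X := G.obj b) (Y := M) f
  map_comp {M _ _} φ ψ := rmod_hom_ext fun b f =>
    (Category.assoc (show G.obj b ⟶ M from f) φ ψ).symm

/-- An element of a module obtained by restricting. -/
def toElt {b : B} {M : RMod A} : (G.obj b ⟶ M) ≃+ Elt ((restrictedYoneda G).obj M) b :=
  AddEquiv.refl _

variable {G}

lemma ev_toElt {b : B} {M N : RMod A} (φ : M ⟶ N) (f : G.obj b ⟶ M) :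
    ev ((restrictedYoneda G).map φ) b (toElt G f) = toElt G (f ≫ φ) := rfl

variable (G)

instance : (restrictedYoneda G).Additive where
  map_add {M _ φ ψ} := rmod_hom_ext fun b f =>
    Preadditive.comp_add _ _ _ (show G.obj b ⟶ M from f) φ ψ

/-- By Yoneda, morphisms from H_b to Hom(G -, M) are morphisms G b ⟶ M. -/
lemma leftAdjointObjIsDefined_representable (b : B) :
    (restrictedYoneda G).leftAdjointObjIsDefined (representable b) :=
  Functor.CorepresentableBy.isCorepresentable (X := G.obj b)
    { homEquiv := fun {M} => ((toElt G).trans (eltEquiv _ b)).toEquiv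
      homEquiv_comp := fun {M N} φ f => by
        change elt (toElt G (f ≫ φ)) = elt (toElt G f) ≫ (restrictedYoneda G).map φ
        rw [elt_comp, ev_toElt] }

/-- The canonical morphism from a coproduct of representable modules. -/
def fromSigma (N : RMod B) :
    (∐ fun j : Σ b, Elt N b => representable j.1) ⟶ N := Sigma.desc fun j => elt j.2

instance epi_fromSigma (N : RMod B) : Epi (fromSigma N) := epi_of_surjective _ fun b x => by
  refine ⟨ev (Sigma.ι (fun j : Σ b, Elt N b => representable j.1) ⟨b, x⟩) b (𝟙 b), ?_⟩
  have h : Sigma.ι (fun j : Σ b, Elt N b => representable j.1) ⟨b, x⟩ ≫ fromSigma N = elt x :=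
    Sigma.ι_desc _ _
  exact (congrArg (fun g => ev g b (𝟙 b)) h).trans (act_id N x)

/-- The objects where a left adjoint is defined are closed under existing colimits. They include
representables, hence their coproducts, and every module is the cokernel of a morphism between such
coproducts. -/
lemma restrictedYoneda_isRightAdjoint : (restrictedYoneda G).IsRightAdjoint := by
  refine Functor.isRightAdjoint_of_leftAdjointObjIsDefined_eq_top ?_
  have h (N : RMod B) : (restrictedYoneda G).leftAdjointObjIsDefined
      (∐ fun j : Σ b, Elt N b => representable j.1) :=
    Functor.leftAdjointObjIsDefined_colimit _ fun _ =>
      leftAdjointObjIsDefined_representable G _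
  ext N
  simp only [Pi.top_apply, Prop.top_eq_true, iff_true]
  let q := fromSigma N
  have := epi_fromSigma (kernel q)
  let f := fromSigma (kernel q) ≫ kernel.ι q
  let hc : IsColimit (CokernelCofork.ofπ q (f := f) (by simp [f])) :=
    isCokernelEpiComp (Abelian.epiIsCokernelOfKernel _ (kernelIsKernel q)) (fromSigma (kernel q)) rfl
  refine Functor.leftAdjointObjIsDefined_of_isColimit hc ?_
  rintro (_ | _)
  · exact h _
  · exact h _

section RightAdjoint

/-- The values of the right adjoint of `restrictedYoneda G`. -/
def coinduced (N : RMod B) : RMod A :=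
  moduleOfAct (fun a => (restrictedYoneda G).obj (representable a) ⟶ N)
    (fun {a b} r => Preadditive.leftComp N ((restrictedYoneda G).map (elt (M := representable b) r)))
    (fun a f => by
      have h : elt (M := representable a) (𝟙 a) = 𝟙 _ := elt_ev_id (𝟙 _)
      simp [Preadditive.leftComp, h])
    (fun {a b c} r t f => by
      have h : elt (M := representable c) (r ≫ t) =
        elt (M := representable b) r ≫ elt (M := representable c) t := (elt_comp_elt _ _).symm
      simp [Preadditive.leftComp, h])
    (fun {a b} r t f => by
      have h : elt (M := representable b) (r + t) =
        elt (M := representable b) r + elt (M := representable b) t := elt_add _ _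
      simp [Preadditive.leftComp, h])

variable {G}

/-- The transpose of a morphism. -/
def coindTranspose {M : RMod A} {N : RMod B} (φ : (restrictedYoneda G).obj M ⟶ N) :
    M ⟶ coinduced G N :=
  homOfEv (fun a => AddMonoidHom.mk' (fun m => (restrictedYoneda G).map (elt m) ≫ φ)
      fun m m' => by
        rw [elt_add, Functor.map_add, Preadditive.add_comp]
        rfl)
    fun {a b} r m => by
      change (restrictedYoneda G).map (elt (act M r m)) ≫ φ =
        (restrictedYoneda G).map (elt (M := representable b) r) ≫
          (restrictedYoneda G).map (elt m) ≫ φ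
      rw [← elt_comp_elt, Functor.map_comp, Category.assoc]

/-- The pairing defined by a morphism to a coinduced module. -/
def coindPairing {M : RMod A} {N : RMod B} (ψ : M ⟶ coinduced G N) {a : A} {b : B} (m : Elt M a) :
    (G.obj b ⟶ representable a) →+ Elt N b :=
  (ev (show (restrictedYoneda G).obj (representable a) ⟶ N from ev ψ a m) b).comp
    (toElt G).toAddMonoidHom

lemma coindPairing_add {M : RMod A} {N : RMod B} (ψ : M ⟶ coinduced G N) {a : A} {b : B}
    (m m' : Elt M a) (s : G.obj b ⟶ representable a) :
    coindPairing ψ (m + m') s = coindPairing ψ m s + coindPairing ψ m' s := by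
  unfold coindPairing
  rw [map_add]
  rfl

lemma coindPairing_act {M : RMod A} {N : RMod B} (ψ : M ⟶ coinduced G N) {a c : A} {b : B}
    (r : a ⟶ c) (m : Elt M c) (s : G.obj b ⟶ representable a) :
    coindPairing ψ (act M r m) s = coindPairing ψ m (s ≫ elt (M := representable c) r) := by
  unfold coindPairing
  rw [ev_act]
  rfl

lemma coindPairing_map {M : RMod A} {N : RMod B} (ψ : M ⟶ coinduced G N) {a : A} {b b' : B}
    (g : b ⟶ b') (m : Elt M a) (s : G.obj b' ⟶ representable a) :
    coindPairing ψ m (G.map g ≫ s) = act N g (coindPairing ψ m s) :=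
  ev_act _ g (toElt G s)

variable {ι : B → Type} [∀ b, Fintype (ι b)] (β : ∀ b, DualBasis (G.obj b) (ι b))

/-- The inverse of the transpose on elements. -/
def coindLift {M : RMod A} {N : RMod B} (ψ : M ⟶ coinduced G N) (b : B) :
    (G.obj b ⟶ M) →+ Elt N b :=
  AddMonoidHom.mk' (fun f => ∑ k, coindPairing ψ (ev f _ ((β b).gen k)) ((β b).coord k))
    fun f g => by simp only [ev_add, coindPairing_add, Finset.sum_add_distrib]

lemma DualBasis.eq_sum_comp_elt {P M : RMod A} {κ : Type} [Fintype κ] (β : DualBasis P κ)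
    (f : P ⟶ M) : f = ∑ k, β.coord k ≫ elt (ev f _ (β.gen k)) := by
  conv_lhs => rw [← Category.id_comp f, β.id_eq_sum, Preadditive.sum_comp]
  simp only [Category.assoc, elt_comp]

lemma coindLift_comp_elt {M : RMod A} {N : RMod B} (ψ : M ⟶ coinduced G N) {a : A} {b : B}
    (m : Elt M a) (s : G.obj b ⟶ representable a) :
    coindLift β ψ b (s ≫ elt m) = coindPairing ψ m s := by
  conv_rhs => rw [(β b).eq_sum_comp_elt s, map_sum]
  exact Finset.sum_congr rfl fun k _ => coindPairing_act ψ (ev s _ ((β b).gen k)) m _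

lemma coindLift_map {M : RMod A} {N : RMod B} (ψ : M ⟶ coinduced G N) {b b' : B}
    (g : b ⟶ b') (f : G.obj b' ⟶ M) :
    coindLift β ψ b (G.map g ≫ f) = act N g (coindLift β ψ b' f) := by
  conv_lhs => rw [(β b').eq_sum_comp_elt f, Preadditive.comp_sum, map_sum]
  conv_rhs => rw [(β b').eq_sum_comp_elt f, map_sum, map_sum]
  refine Finset.sum_congr rfl fun k _ => ?_
  rw [← Category.assoc, coindLift_comp_elt, coindLift_comp_elt, coindPairing_map]

-- Dual bases of the G b are what make this work: each f : G b ⟶ M is a finite sum of composites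
-- through representables, and on these a morphism out of Hom(G -, M) is prescribed by its
-- transpose.
include β in
lemma coindTranspose_bijective (M : RMod A) (N : RMod B) :
    Function.Bijective (coindTranspose (G := G) (M := M) (N := N)) := by
  refine ⟨fun φ φ' h => rmod_hom_ext fun b f => ?_, fun ψ => ?_⟩
  · obtain ⟨f, rfl⟩ := (toElt G).surjective f
    rw [(β b).eq_sum_comp_elt f, map_sum, map_sum, map_sum]
    refine Finset.sum_congr rfl fun k _ => ?_
    have hk : (restrictedYoneda G).map (elt (ev f _ ((β b).gen k))) ≫ φ =
        (restrictedYoneda G).map (elt (ev f _ ((β b).gen k))) ≫ φ' :=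
      congrArg (fun χ => ev χ _ (ev f _ ((β b).gen k))) h
    exact congrArg (fun χ => ev χ b (toElt G ((β b).coord k))) hk
  · refine ⟨homOfEv (M := (restrictedYoneda G).obj M) (coindLift β ψ)
      fun g f => coindLift_map β ψ g f, rmod_hom_ext fun a m => ?_⟩
    refine rmod_hom_ext (M := (restrictedYoneda G).obj (representable a)) (N := N)
      (f := (restrictedYoneda G).map (elt m) ≫ homOfEv _ _) fun b s => ?_
    exact coindLift_comp_elt β ψ m s

include β in
lemma restrictedYoneda_isLeftAdjoint : (restrictedYoneda G).IsLeftAdjoint := by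
  refine Functor.isLeftAdjoint_of_rightAdjointObjIsDefined_eq_top ?_
  ext N
  simp only [Pi.top_apply, Prop.top_eq_true, iff_true]
  refine Functor.RepresentableBy.isRepresentable (Y := coinduced G N)
    { homEquiv := fun {M} => (Equiv.ofBijective _ (coindTranspose_bijective β M N)).symm
      homEquiv_comp := fun {M M'} f g => ?_ }
  rw [Equiv.symm_apply_eq]
  obtain ⟨φ, rfl⟩ := (coindTranspose_bijective β M' N).2 g
  refine rmod_hom_ext fun a m => ?_
  have h : (Equiv.ofBijective _ (coindTranspose_bijective β M' N)).symm (coindTranspose φ) = φ :=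
    Equiv.symm_apply_apply (Equiv.ofBijective _ (coindTranspose_bijective β M' N)) φ
  rw [h]
  change (restrictedYoneda G).map (elt (ev f a m)) ≫ φ =
    (restrictedYoneda G).map (elt m) ≫ (restrictedYoneda G).map f ≫ φ
  rw [← elt_comp, Functor.map_comp, Category.assoc]

end RightAdjoint

/-- Full faithfulness identifies H_b with Hom(G -, G b). Under this, the counit at N, evaluated at
b, becomes the chain of bijections Hom(G b, J N) ≅ Hom(H_b, N) ≅ N(b). -/
lemma isIso_counit_of_fullyFaithful [G.Full] [G.Faithful] {J : RMod B ⥤ RMod A}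
    (adj : restrictedYoneda G ⊣ J) : IsIso adj.counit := by
  have (N : RMod B) : IsIso (adj.counit.app N) := by
    refine isIso_of_bijective _ fun b => ?_
    let y : representable b ⟶ (restrictedYoneda G).obj (G.obj b) := elt (toElt G (𝟙 (G.obj b)))
    have : IsIso y := by
      refine isIso_of_bijective _ fun b' => ?_
      have h : ⇑(ev y b') = fun r : b' ⟶ b => toElt G (G.map r) := by
        funext r
        change toElt G (G.map r ≫ 𝟙 _) = _
        rw [Category.comp_id]
      rw [h]
      exact (toElt G).bijective.comp ⟨G.map_injective, G.map_surjective⟩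
    let e : (G.obj b ⟶ J.obj N) ≃ Elt N b :=
      (adj.homEquiv (G.obj b) N).symm.trans
        (((asIso y).homFromEquiv).symm.trans (eltEquiv N b).symm.toEquiv)
    have hy (x : G.obj b ⟶ J.obj N) : y ≫ (adj.homEquiv (G.obj b) N).symm x =
        elt (ev (adj.counit.app N) b (toElt G x)) := by
      rw [adj.homEquiv_counit, ← Category.assoc, elt_comp, ev_toElt, Category.id_comp, elt_comp]
    have h : ⇑(ev (adj.counit.app N) b) = e := funext fun x =>
      ((congrArg (eltEquiv N b).symm (hy x)).trans ((eltEquiv N b).symm_apply_apply _)).symm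
    rw [h]
    exact e.bijective
  exact NatIso.isIso_of_isIso_app _

end RestrictedYoneda

/-! ### Restriction along an additive functor. -/

section Pullback

variable {A C : Type u} [SmallCategory A] [Preadditive A] [SmallCategory C] [Preadditive C]
  (F : A ⥤ C) [F.Additive]

/-- Restriction of modules along an additive functor. -/
def pullback : RMod C ⥤ RMod A where
  obj N := moduleOfAct (fun a => Elt N (F.obj a)) (fun r => act N (F.map r))
    (fun a x => by simp) (fun r t x => by rw [F.map_comp, act_comp])
    (fun r t x => by rw [F.map_add, act_add])
  map φ := homOfEv (fun a => ev φ (F.obj a)) fun r x => ev_act φ (F.map r) x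

/-- The functor `a ↦ C(-, F a)`. -/
def representableComp : A ⥤ RMod C where
  obj a := representable (F.obj a)
  map {_ b} r := elt (M := representable (F.obj b)) (F.map r)
  map_id a := (congrArg (elt (M := representable (F.obj a))) (F.map_id a)).trans (elt_ev_id (𝟙 _))
  map_comp {_ _ c} r t := (congrArg (elt (M := representable (F.obj c))) (F.map_comp r t)).trans
    (elt_comp_elt (M := representable (F.obj c)) (F.map r) (F.map t)).symm

instance : (representableComp F).Additive where
  map_add {_ b _ _} := (congrArg (elt (M := representable (F.obj b))) F.map_add).trans
    (elt_add (M := representable (F.obj b)) _ _)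

/-- Restriction is an instance of `restrictedYoneda`. -/
def pullbackIso : pullback F ≅ restrictedYoneda (representableComp F) :=
  let α (N : RMod C) : (pullback F).obj N ⟶ (restrictedYoneda (representableComp F)).obj N :=
    homOfEv (fun a => (eltEquiv N (F.obj a)).toAddMonoidHom)
      fun r x => (elt_comp_elt (M := N) (F.map r) x).symm
  have (N : RMod C) : IsIso (α N) :=
    isIso_of_bijective _ fun a => (eltEquiv N (F.obj a)).bijective
  NatIso.ofComponents (fun N => asIso (α N)) fun {N _} φ =>
    rmod_hom_ext fun _ x => (elt_comp (M := N) x φ).symm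

/-- The one-element dual basis of a representable module. -/
def representableDualBasis (c : C) : DualBasis (representable c) Unit :=
  DualBasis.ofIdEqSum (fun _ => c) (fun _ => 𝟙 _) (fun _ => 𝟙 _) (by simp)

instance : (pullback F).IsLeftAdjoint :=
  have : (restrictedYoneda (representableComp F)).IsLeftAdjoint :=
    restrictedYoneda_isLeftAdjoint fun a => representableDualBasis (F.obj a)
  Functor.isLeftAdjoint_of_iso (pullbackIso F).symm

instance : (pullback F).IsRightAdjoint :=
  have := restrictedYoneda_isRightAdjoint (representableComp F)
  Functor.isRightAdjoint_of_iso (pullbackIso F).symm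

instance : (pullback F).Additive where

end Pullback

/-! ### Modules over the quotient by an ideal. -/

section QuotientCategory

variable {A : Type u} [SmallCategory A] [Preadditive A] (I : CatIdeal A)

/-- Congruence modulo an ideal. -/
def CatIdeal.rel : HomRel A := fun a b f g => f - g ∈ I.carrier a b

instance : Congruence I.rel where
  equivalence {a b} :=
    { refl := fun f => by simp [CatIdeal.rel]
      symm := fun {f g} h => by
        have := neg_mem h
        rwa [neg_sub] at this
      trans := fun {f g k} h h' => by
        have := add_mem h h'
        rwa [sub_add_sub_cancel] at this }
  comp_left f _ _ h := by
    have := I.comp_mem_left f h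
    rwa [Preadditive.comp_sub] at this
  comp_right g h := by
    have := I.comp_mem_right g h
    rwa [Preadditive.sub_comp] at this

/-- The quotient of a preadditive category by an ideal. -/
abbrev CatIdeal.Quot : Type u := CategoryTheory.Quotient I.rel

lemma CatIdeal.rel_add ⦃a b : A⦄ (f f' g g' : a ⟶ b) (h : I.rel f f') (h' : I.rel g g') :
    I.rel (f + g) (f' + g') := by
  have := add_mem h h'
  rwa [sub_add_sub_comm] at this

instance : Preadditive I.Quot := Quotient.preadditive I.rel I.rel_add

/-- The quotient functor. -/
abbrev CatIdeal.quotFunctor : A ⥤ I.Quot := Quotient.functor I.rel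

instance : I.quotFunctor.Additive := Quotient.functor_additive I.rel I.rel_add

instance : (pullback I.quotFunctor).Faithful where
  map_injective {_ _ _ _} h := rmod_hom_ext fun a x =>
    congrArg (fun χ => ev χ a.as x) h

instance : (pullback I.quotFunctor).Full where
  map_surjective {M N} ψ := ⟨homOfEv (fun a => ev ψ a.as) fun {a b} r x => by
    obtain ⟨r, rfl⟩ := I.quotFunctor.map_surjective (X := a.as) (Y := b.as) r
    exact ev_act ψ r x, rfl⟩

lemma essImage_pullback_quotFunctor : (pullback I.quotFunctor).essImage = killedBy I := by
  ext M
  refine ⟨?_, fun hM => ?_⟩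
  · rintro ⟨N, ⟨e⟩⟩ a b r hr x
    have hx : x = ev e.hom b (ev e.inv b x) := by
      rw [← ev_comp, e.inv_hom_id, ev_id]
    have h0 : I.quotFunctor.map r = I.quotFunctor.map 0 :=
      (Quotient.functor_map_eq_iff _ _ _).2 (by simpa [CatIdeal.rel] using hr)
    rw [hx, ← ev_act]
    have : act ((pullback I.quotFunctor).obj N) r (ev e.inv b x) = 0 := by
      change act N (I.quotFunctor.map r) _ = 0
      rw [h0, Functor.map_zero]
      exact act_zero_left N _
    rw [this, map_zero]
  -- The congruence is on A, not on its opposite, so M is turned into a covariant functor before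
  -- being descended to A/I.
  · let F : I.Quot ⥤ AddCommGrpCat.{u}ᵒᵖ := CategoryTheory.Quotient.lift I.rel M.obj.rightOp
      fun a b f g h => by
      apply Quiver.Hom.unop_inj
      ext x
      have := hM (f - g) h x
      change act M f x = act M g x
      rw [← sub_eq_zero]
      exact (map_sub (actHom M x) f g).symm.trans this
    have : F.leftOp.Additive := ⟨fun {a b f g} => by
      obtain ⟨f', hf⟩ := I.quotFunctor.map_surjective (X := b.unop.as) (Y := a.unop.as) f.unop
      obtain ⟨g', hg⟩ := I.quotFunctor.map_surjective (X := b.unop.as) (Y := a.unop.as) g.unop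
      obtain rfl : (I.quotFunctor.map f').op = f := congrArg Quiver.Hom.op hf
      obtain rfl : (I.quotFunctor.map g').op = g := congrArg Quiver.Hom.op hg
      change F.leftOp.map (I.quotFunctor.map f' + I.quotFunctor.map g').op = _
      rw [← Functor.map_add]
      exact M.obj.map_add (f := f'.op) (g := g'.op)⟩
    exact ⟨AdditiveFunctor.of F.leftOp, ⟨Iso.refl M⟩⟩

end QuotientCategory

/-! ### The recollement defined by finitely generated projectives. -/

section Construction

variable {A : Type u} [SmallCategory A] [Preadditive A]

lemma exists_recollement {ι : Type u} (P : ι → RMod A) (hP : ∀ i, IsFinGenProj (P i)) :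
    ∃ R : Recollement (RMod A), R.IsByModules ∧
      R.ttf.T = (ObjectProperty.ofObj P).rightOrthogonal := by
  let I : CatIdeal A := traceIdeal (ObjectProperty.ofObj P)
  let G : InducedCategory (RMod A) P ⥤ RMod A := inducedFunctor P
  choose n hn using fun i => (hP i).exists_dualBasis
  have hj : (restrictedYoneda G).IsLeftAdjoint :=
    restrictedYoneda_isLeftAdjoint fun i => (hn i).some
  have hj' := restrictedYoneda_isRightAdjoint G
  let adj := Adjunction.ofIsLeftAdjoint (restrictedYoneda G)
  let adj' := Adjunction.ofIsRightAdjoint (restrictedYoneda G)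
  have hc : IsIso adj.counit := isIso_counit_of_fullyFaithful G adj
  -- In an adjoint triple the outer functors are fully faithful together, so j_! inherits this from
  -- j_*.
  let t : Adjunction.Triple _ _ _ := ⟨adj', adj⟩
  have hu : IsIso adj'.unit := t.isIso_unit_iff_isIso_counit.2 hc
  let i := pullback I.quotFunctor
  let adj₁ := Adjunction.ofIsRightAdjoint i
  let adj₂ := Adjunction.ofIsLeftAdjoint i
  have hi : i.essImage = (ObjectProperty.ofObj P).rightOrthogonal := by
    rw [essImage_pullback_quotFunctor, rightOrthogonal_eq_killedBy (isFinGenProj_of_ofObj hP)]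
  let R : Recollement (RMod A) :=
    { Y := RMod I.Quot
      X := RMod (InducedCategory (RMod A) P)
      iLowerStar := i
      iUpperStar := _
      iUpperShriek := _
      jUpperStar := restrictedYoneda G
      jLowerShriek := _
      jLowerStar := _
      additive_iLowerStar := inferInstance
      additive_iUpperStar := adj₁.left_adjoint_additive
      additive_iUpperShriek := adj₂.right_adjoint_additive
      additive_jUpperStar := inferInstance
      additive_jLowerShriek := adj'.left_adjoint_additive
      additive_jLowerStar := adj.right_adjoint_additive
      adj_i₁ := adj₁
      adj_i₂ := adj₂
      adj_j₁ := adj'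
      adj_j₂ := adj
      full_iLowerStar := inferInstance
      faithful_iLowerStar := inferInstance
      full_jLowerShriek := adj'.fullyFaithfulLOfIsIsoUnit.full
      faithful_jLowerShriek := adj'.fullyFaithfulLOfIsIsoUnit.faithful
      full_jLowerStar := adj.fullyFaithfulROfIsIsoCounit.full
      faithful_jLowerStar := adj.fullyFaithfulROfIsIsoCounit.faithful
      image_eq_kernel := by
        rw [hi]
        ext M
        refine Iff.trans ?_ (isZero_iff_elt _).symm
        refine ⟨fun h b f => h (show G.obj b ⟶ M from f) (ObjectProperty.ofObj_apply P b), ?_⟩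
        rintro h _ f ⟨b⟩
        exact h b f }
  exact ⟨R, ⟨⟨_, _, _, ⟨CategoryTheory.Equivalence.refl⟩⟩,
    ⟨_, _, _, ⟨CategoryTheory.Equivalence.refl⟩⟩⟩, hi⟩

end Construction

/-! ### Assembling the bijections. -/

section Correspondences

variable (A : Type u) [SmallCategory A] [Preadditive A]

/-- The TTF triple of an equivalence class of recollements. -/
def ttfOfClass : RecollementClasses A → FgpTTFTriples A :=
  _root_.Quotient.lift (fun R => ⟨R.1.ttf, by
    obtain ⟨B, _, _, ⟨e⟩⟩ := R.2.2
    exact R.1.ttf_isFgpGenerated e⟩) fun _ _ h => Subtype.ext h.ttf_eq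

lemma ttfOfClass_bijective : Function.Bijective (ttfOfClass A) := by
  refine ⟨?_, ?_⟩
  · rintro ⟨R⟩ ⟨R'⟩ h
    exact _root_.Quotient.sound (R.1.equiv_of_ttf_eq (congrArg Subtype.val h))
  · rintro ⟨τ, ι, P, hP, hτ⟩
    obtain ⟨R, hR, hT⟩ := exists_recollement P hP
    exact ⟨⟦⟨R, hR⟩⟧, Subtype.ext (TTFTriple.eq_of_T_eq (hT.trans hτ.symm))⟩

variable {A}

/-- The ideal of the morphisms that act as zero on a TTF class. -/
def annihilator (τ : TTFTriple (RMod A)) : CatIdeal A where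
  carrier a b := ⨅ (M : RMod A) (_ : τ.T M) (x : Elt M b), (actHom (a := a) M x).ker
  comp_mem {a' a b b'} r f l hf := by
    simp only [AddSubgroup.mem_iInf, AddMonoidHom.mem_ker, actHom_apply] at hf ⊢
    intro M hM x
    rw [act_comp, act_comp, hf M hM, map_zero]

lemma mem_annihilator {τ : TTFTriple (RMod A)} {a b : A} {r : a ⟶ b} :
    r ∈ (annihilator τ).carrier a b ↔ ∀ M, τ.T M → ∀ x : Elt M b, act M r x = 0 := by
  simp [annihilator, AddSubgroup.mem_iInf]

lemma mem_annihilator_iff_annihilates {τ : TTFTriple (RMod A)} {a b : A} {r : a ⟶ b} :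
    r ∈ (annihilator τ).carrier a b ↔ τ.Annihilates r := by
  rw [mem_annihilator]
  refine forall₂_congr fun M _ => ⟨fun h => ?_, fun h x => ?_⟩
  · ext x
    exact h x
  · exact ConcreteCategory.congr_hom h x

lemma annihilator_eq {τ : TTFTriple (RMod A)} {I : CatIdeal A} (h : τ.T = killedBy I) :
    annihilator τ = I :=
  CatIdeal.ext_of_mem fun a b r => by
    rw [mem_annihilator, h, ← mem_iff_forall_killedBy]

lemma TTFTriple.IsFgpGenerated.exists_eq {τ : TTFTriple (RMod A)} (h : τ.IsFgpGenerated) :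
    ∃ S : ObjectProperty (RMod A), (∀ P, S P → IsFinGenProj P) ∧
      τ.T = killedBy (traceIdeal S) := by
  obtain ⟨ι, P, hP, h⟩ := h
  exact ⟨_, isFinGenProj_of_ofObj hP,
    h.trans (rightOrthogonal_eq_killedBy (isFinGenProj_of_ofObj hP))⟩

lemma TTFTriple.IsFgpGenerated.T_eq {τ : TTFTriple (RMod A)} (h : τ.IsFgpGenerated) :
    τ.T = killedBy (annihilator τ) := by
  obtain ⟨S, -, h⟩ := h.exists_eq
  rw [annihilator_eq h, h]

/-- The annihilator of a TTF class generated by finitely generated projective modules. -/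
def fgpAnnihilator (τ : FgpTTFTriples A) : FgpTraceIdeals A :=
  ⟨annihilator τ.1, by
    obtain ⟨S, hS, h⟩ := τ.2.exists_eq
    rw [annihilator_eq h]
    exact ⟨isIdempotent_traceIdeal hS, isFgpTrace_traceIdeal hS⟩⟩

lemma fgpAnnihilator_bijective : Function.Bijective (fgpAnnihilator (A := A)) := by
  refine ⟨fun τ τ' h => Subtype.ext (TTFTriple.eq_of_T_eq ?_), ?_⟩
  · have h' : annihilator τ.1 = annihilator τ'.1 := congrArg Subtype.val h
    rw [τ.2.T_eq, τ'.2.T_eq, h']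
  · rintro ⟨_, -, ι, P, hP, rfl⟩
    -- The TTF axioms for the orthogonal of the P_i come for free from the recollement they define.
    obtain ⟨R, -, hT⟩ := exists_recollement P hP
    refine ⟨⟨R.ttf, ι, P, hP, hT⟩, Subtype.ext (annihilator_eq ?_)⟩
    exact hT.trans (rightOrthogonal_eq_killedBy (isFinGenProj_of_ofObj hP))

end Correspondences

end RingsSeveralObjects

end

theorem theoremC (A : Type u) [SmallCategory A] [Preadditive A] :
    ∃ (e₁₂ : RingsSeveralObjects.RecollementClasses A ≃ RingsSeveralObjects.FgpTTFTriples A)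
      (e₂₃ : RingsSeveralObjects.FgpTTFTriples A ≃ RingsSeveralObjects.FgpTraceIdeals A)
      (e₃₄ : RingsSeveralObjects.FgpTraceIdeals A ≃
        RingsSeveralObjects.IdempotentGeneratedIdeals A)
      (e₅₃ : RingsSeveralObjects.CauchySubcategories A ≃ RingsSeveralObjects.FgpTraceIdeals A),
      (∀ R : RingsSeveralObjects.ModuleRecollement A,
        (e₁₂ ⟦R⟧).1.C = R.1.iUpperStar.kernel ∧
        (e₁₂ ⟦R⟧).1.T = R.1.iLowerStar.essImage ∧
        (e₁₂ ⟦R⟧).1.F = R.1.iUpperShriek.kernel) ∧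
      (∀ (τ : RingsSeveralObjects.FgpTTFTriples A) (a b : A) (r : a ⟶ b),
        r ∈ (e₂₃ τ).1.carrier a b ↔ τ.1.Annihilates r) ∧
      (∀ (I : RingsSeveralObjects.FgpTraceIdeals A) (a b : A) (r : a ⟶ b),
        r ∈ I.1.carrier a b ↔
          (Mat_.embedding A).map r ∈
            (e₃₄ I).1.carrier ((Mat_.embedding A).obj a) ((Mat_.embedding A).obj b)) ∧
      (∀ X : RingsSeveralObjects.CauchySubcategories A,
        (e₅₃ X).1 =
          RingsSeveralObjects.traceIdeal (RingsSeveralObjects.cauchyModules X.1)) := by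
  let e := Equiv.ofBijective _ (RingsSeveralObjects.restrictIdeals_bijective (A := A))
  refine ⟨Equiv.ofBijective _ (RingsSeveralObjects.ttfOfClass_bijective A),
    Equiv.ofBijective _ RingsSeveralObjects.fgpAnnihilator_bijective, e.symm,
    Equiv.ofBijective _ RingsSeveralObjects.traceOfSubcategory_bijective,
    fun R => ⟨rfl, rfl, rfl⟩, fun τ a b r => RingsSeveralObjects.mem_annihilator_iff_annihilates,
    fun I a b r => ?_, fun X => rfl⟩
  obtain ⟨J, rfl⟩ := e.surjective I
  rw [Equiv.symm_apply_apply]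
  exact RingsSeveralObjects.mem_resIdeal
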